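/- Let $K$ be a perfect field of characteristic $p>0$ with algebraic closure $\bar K$. Let $C$ be a curve over $K$, i.e. a smooth, projective, geometrically irreducible $K$-scheme of dimension $1$, and let $S,T$ be finite subsets of $C(\bar K)$ such that $S$ is disjoint from the set of $\mathrm{Gal}(\bar K/K)$-conjugates of elements of $T$. Then there exists a finite morphism $\varphi\colon C\to\mathbb{P}^1$ defined over $K$ such that - $\mathrm{br}(\varphi)=\{\infty\}$, where the branch locus $\mathrm{br}(\varphi)\subseteq\mathbb{P}^1(\bar K)$ is the set of images $\varphi(P)$ of the points $P\in C(\bar K)$ at which $\varphi$ is ramified; - $\varphi$ is ramified at every point of $S$; - $\infty\notin\varphi(T)$. -/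

import Mathlib

open CategoryTheory AlgebraicGeometry

universe u

noncomputable section

namespace BelyiCharP

attribute [local instance] MvPolynomial.gradedAlgebra

/-! ### Projective space -/

section ProjectiveSpace

variable (n : ℕ) (K : Type u) [Field K]

/-- Projective `n`-space `ℙⁿ = Proj K[X₀, …, Xₙ]` over a field `K`. -/
abbrev ProjSpace : Scheme.{u} :=
  Proj (MvPolynomial.homogeneousSubmodule (Fin (n + 1)) K)

/-- The structure morphism `ℙⁿ ⟶ Spec K`. -/
def ProjSpace.toSpec : ProjSpace n K ⟶ Spec (CommRingCat.of K) :=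
  Proj.toSpecZero (MvPolynomial.homogeneousSubmodule (Fin (n + 1)) K) ≫
    Spec.map (CommRingCat.ofHom
      (algebraMap K (MvPolynomial.homogeneousSubmodule (Fin (n + 1)) K 0)))

end ProjectiveSpace

/-! ### Curves and their geometric points -/

/-- `f : C ⟶ Spec K` is a smooth, projective, geometrically irreducible curve over `K`. -/
structure IsCurve {K : Type u} [Field K] {C : Scheme.{u}} (f : C ⟶ Spec (CommRingCat.of K)) :
    Prop where
  smooth : SmoothOfRelativeDimension 1 f
  projective : ∃ (n : ℕ) (i : C ⟶ ProjSpace n K),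
    IsClosedImmersion i ∧ i ≫ ProjSpace.toSpec n K = f
  geometricallyIrreducible : GeometricallyIrreducible f

section GeomPoint

variable {K : Type u} [Field K]

/-- The morphism `Spec K̄ ⟶ Spec K`, where `K̄` is the algebraic closure of `K`. -/
def specClosure (K : Type u) [Field K] :
    Spec (CommRingCat.of (AlgebraicClosure K)) ⟶ Spec (CommRingCat.of K) :=
  Spec.map (CommRingCat.ofHom (algebraMap K (AlgebraicClosure K)))

/-- The set `X(K̄)` of `K̄`-points of a `K`-scheme `f : X ⟶ Spec K`: the `K`-morphisms
`Spec K̄ ⟶ X`. -/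
@[ext]
structure GeomPoint {X : Scheme.{u}} (f : X ⟶ Spec (CommRingCat.of K)) where
  /-- the underlying morphism -/
  hom : Spec (CommRingCat.of (AlgebraicClosure K)) ⟶ X
  w : hom ≫ f = specClosure K

/-- The point of the underlying topological space of `X` at which a `K̄`-point is centred. -/
def GeomPoint.pt {X : Scheme.{u}} {f : X ⟶ Spec (CommRingCat.of K)} (x : GeomPoint f) : X :=
  x.hom (IsLocalRing.closedPoint (AlgebraicClosure K))

/-- The image `φ(x) ∈ Y(K̄)` of `x ∈ X(K̄)` under a `K`-morphism `φ : X ⟶ Y`. -/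
def GeomPoint.map {X Y : Scheme.{u}} {f : X ⟶ Spec (CommRingCat.of K)}
    {g : Y ⟶ Spec (CommRingCat.of K)} (φ : X ⟶ Y) (hφ : φ ≫ g = f) (x : GeomPoint f) :
    GeomPoint g where
  hom := x.hom ≫ φ
  w := by rw [Category.assoc, hφ, x.w]

/-- The conjugate `σ(x)` of `x ∈ X(K̄)` by `σ ∈ Gal(K̄/K)`. On coordinates this is the
coordinatewise action of `σ`. -/
def GeomPoint.conj {X : Scheme.{u}} {f : X ⟶ Spec (CommRingCat.of K)}
    (σ : AlgebraicClosure K ≃ₐ[K] AlgebraicClosure K) (x : GeomPoint f) : GeomPoint f where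
  hom := Spec.map (CommRingCat.ofHom (σ : AlgebraicClosure K →+* AlgebraicClosure K)) ≫ x.hom
  w := by
    rw [Category.assoc, x.w, specClosure, ← Spec.map_comp, ← CommRingCat.ofHom_comp]
    congr 2
    ext a
    simp

end GeomPoint

/-! ### The point `∞` of the projective line -/

section Infinity

variable (K : Type u) [Field K]

/-- The ring homomorphism `K[X₀, X₁] → K`, `X₀ ↦ 1`, `X₁ ↦ 0`, with values in the global sections
of `Spec K`. -/
def evalInfty : MvPolynomial (Fin (1 + 1)) K →+* Γ(Spec (CommRingCat.of K), ⊤) :=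
  (Scheme.ΓSpecIso (CommRingCat.of K)).inv.hom.comp
    (MvPolynomial.eval (![1, 0] : Fin (1 + 1) → K))

lemma evalInfty_irrelevant :
    (HomogeneousIdeal.irrelevant
      (MvPolynomial.homogeneousSubmodule (Fin (1 + 1)) K)).toIdeal.map (evalInfty K) = ⊤ := by
  rw [Ideal.eq_top_iff_one]
  have h : evalInfty K (MvPolynomial.X 0) = 1 := by simp [evalInfty]
  rw [← h]
  refine Ideal.mem_map_of_mem _ ?_
  rw [HomogeneousIdeal.mem_iff, HomogeneousIdeal.mem_irrelevant_iff,
    GradedRing.proj_apply, DirectSum.decompose_of_mem_ne _ (i := 1) _ one_ne_zero]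
  exact MvPolynomial.isHomogeneous_X _ _

/-- The `K`-rational point `∞ = [1 : 0]` of `ℙ¹`, as a morphism `Spec K ⟶ ℙ¹`. Here the affine
coordinate on `ℙ¹ ∖ {∞}` is `X₀ / X₁`. -/
def inftyHom : Spec (CommRingCat.of K) ⟶ ProjSpace 1 K :=
  Proj.fromOfGlobalSections (MvPolynomial.homogeneousSubmodule (Fin (1 + 1)) K)
    (evalInfty K) (evalInfty_irrelevant K)

lemma inftyHom_toSpec : inftyHom K ≫ ProjSpace.toSpec 1 K = 𝟙 _ := by
  have h := Proj.fromOfGlobalSections_toSpecZero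
    (MvPolynomial.homogeneousSubmodule (Fin (1 + 1)) K) (evalInfty K) (evalInfty_irrelevant K)
  have h2 : ((evalInfty K).comp (algebraMap (MvPolynomial.homogeneousSubmodule (Fin (1 + 1)) K 0)
      (MvPolynomial (Fin (1 + 1)) K))).comp (algebraMap K _) =
      (Scheme.ΓSpecIso (CommRingCat.of K)).inv.hom := by
    ext a
    have : (algebraMap (MvPolynomial.homogeneousSubmodule (Fin (1 + 1)) K 0)
      (MvPolynomial (Fin (1 + 1)) K)) (algebraMap K _ a) = MvPolynomial.C a := rfl
    simp only [RingHom.comp_apply, this, evalInfty, MvPolynomial.eval_C]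
  rw [inftyHom, ProjSpace.toSpec, reassoc_of% h, ← Spec.map_comp, ← CommRingCat.ofHom_comp, h2,
    ← SpecMap_ΓSpecIso_hom, CommRingCat.ofHom_hom, ← Spec.map_comp, Iso.inv_hom_id, Spec.map_id]

/-- The point `∞ ∈ ℙ¹(K̄)`. -/
def infty : GeomPoint (ProjSpace.toSpec 1 K) where
  hom := specClosure K ≫ inftyHom K
  w := by rw [Category.assoc, inftyHom_toSpec, Category.comp_id]

end Infinity

/-! ### Ramification -/

section Ramification

variable {K : Type u} [Field K] {X Y : Scheme.{u}} {f : X ⟶ Spec (CommRingCat.of K)}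

/-- A morphism `φ : X ⟶ Y` is ramified at the `K̄`-point `x` of `X` if it is not unramified at the
point `P` of `X` underlying `x`, i.e. if `Ω_{X/Y, P} ≠ 0`. As `Ω` commutes with base change, this
is the same as ramification at `x` of the base change `φ_K̄ : X_K̄ ⟶ Y_K̄`; for a finite morphism of
smooth curves it says that the ramification index of `φ_K̄` at `x` is greater than `1`. -/
def IsRamifiedAt (φ : X ⟶ Y) (x : GeomPoint f) : Prop :=
  ¬ (φ.stalkMap x.pt).hom.FormallyUnramified

/-- The branch locus of a `K`-morphism `φ : X ⟶ Y`, as a subset of `Y(K̄)`: the set of images of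
the points of `X(K̄)` at which `φ` is ramified. -/
def branchLocus {g : Y ⟶ Spec (CommRingCat.of K)} (φ : X ⟶ Y) (hφ : φ ≫ g = f) :
    Set (GeomPoint g) :=
  {y | ∃ x : GeomPoint f, IsRamifiedAt φ x ∧ x.map φ hφ = y}

end Ramification

end BelyiCharP

end

namespace BelyiCharP

/-! In characteristic p, adding a p-th power to a rational function does not change its
differential. Choose a rational function g regular and unramified at the points of T; it is regular
and unramified outside a finite set of closed points. Let Z be the union of that set with S. Choose
h vanishing on Z, a unit at T, with gh regular on Z, and put φ = g + h⁻ᵖ. Where h vanishes and gh is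
regular, φ = h⁻ᵖ(1 + (gh)hᵖ⁻¹) has a pole of order at least p ≥ 2, so the map to ℙ¹ is ramified
there, over ∞. Everywhere else g is unramified and h⁻¹ is regular, so φ is regular with dφ = dg,
hence unramified. All ramification thus lies over ∞, it includes S, and T avoids ∞.

The local input is `IsSmoothCurveLocalRing`: a local ring of the curve is a principal ideal domain
with a derivation d such that a is unramified exactly when da is a unit. The dichotomy for φ is
`isUnramifiedElt_or_exists_inverse`; g and h come from `exists_isRegularUnramifiedAt` and
`IsCurve.exists_denominator`.

The germs of φ glue to a morphism (`exists_hom_of_functionField`). It is not constant because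
unramified elements are transcendental over a perfect field, and a nonconstant morphism from a
proper curve is finite. Finally, `GeomPoint.exists_eq_conj` turns the condition on conjugates into
disjointness of sets of closed points. -/

open Polynomial in
/-- The element `a` of the `K`-algebra `R` is unramified if `K[X] → R`, `X ↦ a`, is formally
unramified. -/
def IsUnramifiedElt {K R : Type*} [CommRing K] [CommRing R] (k : K →+* R) (a : R) : Prop :=
  (eval₂RingHom k a).FormallyUnramified

/-! ### Differentials and local rings of smooth curves -/

section Algebra

open scoped TensorProduct

open Polynomial KaehlerDifferential

/-- The sequence R ⊗ Ω[K[X]/K] → Ω[R/K] → Ω[R/K[X]] → 0 is exact and Ω[K[X]/K] is generated by dX,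
which maps to da. So Ω[R/K[X]] is Ω[R/K] modulo R·da. -/
lemma isUnramifiedElt_iff_span {K R : Type*} [CommRing K] [CommRing R] [Algebra K R] (a : R) :
    IsUnramifiedElt (algebraMap K R) a ↔ Submodule.span R {D K R a} = ⊤ := by
  let : Algebra K[X] R := (eval₂RingHom (algebraMap K R) a).toAlgebra
  have : IsScalarTower K K[X] R := .of_algebraMap_eq fun x ↦ by
    simp [RingHom.algebraMap_toAlgebra]
  have hX : algebraMap K[X] R X = a := by simp [RingHom.algebraMap_toAlgebra]
  have h1 : IsUnramifiedElt (algebraMap K R) a ↔ Subsingleton Ω[R⁄K[X]] := by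
    rw [← Algebra.formallyUnramified_iff]; rfl
  have h2 : Submodule.span R {D K R a} = LinearMap.ker (KaehlerDifferential.map K K[X] R R) := by
    rw [← range_mapBaseChange]
    apply le_antisymm
    · rw [Submodule.span_singleton_le_iff_mem]
      exact ⟨1 ⊗ₜ D K K[X] X, by simp [hX]⟩
    · rintro _ ⟨x, rfl⟩
      induction x with
      | zero => simp
      | add x y hx hy => rw [map_add]; exact add_mem hx hy
      | tmul r y =>
        obtain ⟨q, rfl⟩ := (polynomialEquiv K).symm.surjective y
        rw [mapBaseChange_tmul, polynomialEquiv_symm, map_smul, map_D, hX]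
        refine Submodule.smul_mem _ _ ?_
        rw [algebra_compatible_smul R]
        exact Submodule.smul_mem _ _ (Submodule.mem_span_singleton_self _)
  rw [h1, h2, LinearMap.ker_eq_top]
  constructor
  · intro h; ext x; exact Subsingleton.elim _ _
  · intro h
    refine ⟨fun x y ↦ ?_⟩
    obtain ⟨x, rfl⟩ := KaehlerDifferential.map_surjective K K[X] R x
    obtain ⟨y, rfl⟩ := KaehlerDifferential.map_surjective K K[X] R y
    simp [h]

/-- If `R` is formally étale over `K[X]`, a derivation on `R` detects unramified elements. -/
lemma exists_derivation_of_formallyEtale {K R : Type*} [CommRing K] [CommRing R] [Algebra K R]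
    [Algebra K[X] R] [IsScalarTower K K[X] R] [Algebra.FormallyEtale K[X] R] :
    ∃ d : Derivation K R R, (∀ a, IsUnramifiedElt (algebraMap K R) a ↔ IsUnit (d a)) ∧
      ∃ a, IsUnit (d a) := by
  -- Étaleness gives Ω[R/K] ≅ R ⊗ Ω[K[X]/K] ≅ R, and `d` is the universal derivation read through
  -- this isomorphism.
  let e : R ≃ₗ[R] Ω[R⁄K] :=
    (TensorProduct.AlgebraTensorModule.rid K[X] R R).symm ≪≫ₗ
    (TensorProduct.AlgebraTensorModule.congr (.refl R R) (polynomialEquiv K).symm) ≪≫ₗ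
    tensorKaehlerEquivOfFormallyEtale K K[X] R
  let d : Derivation K R R := e.symm.toLinearMap.compDer (D K R)
  have h (a : R) : IsUnramifiedElt (algebraMap K R) a ↔ IsUnit (d a) := by
    rw [isUnramifiedElt_iff_span, ← Ideal.span_singleton_eq_top]
    have : Ideal.span {d a} = (Submodule.span R {D K R a}).map e.symm.toLinearMap := by
      rw [Submodule.map_span, Set.image_singleton]; rfl
    rw [this]
    constructor
    · intro h; rw [h, Submodule.map_top, LinearMap.range_eq_top]; exact e.symm.surjective
    · intro h
      apply Submodule.map_injective_of_injective e.symm.injective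
      rw [h, Submodule.map_top, eq_comm, LinearMap.range_eq_top]; exact e.symm.surjective
  refine ⟨d, h, algebraMap K[X] R X, ?_⟩
  rw [← h]
  have h3 : eval₂RingHom (algebraMap K R) (algebraMap K[X] R X) = algebraMap K[X] R := by
    ext
    · simp [IsScalarTower.algebraMap_apply K K[X] R]
    · simp
  rw [IsUnramifiedElt, h3, RingHom.formallyUnramified_algebraMap]
  infer_instance

/-- A Noetherian local ring whose maximal ideal is generated by a nonzerodivisor, or by zero, is
a domain all of whose ideals are principal. -/
lemma isDomain_and_isPrincipalIdealRing_of_maximalIdeal_eq_span {R : Type*} [CommRing R]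
    [IsLocalRing R] [IsNoetherianRing R] (ϖ : R) (h : IsLocalRing.maximalIdeal R = Ideal.span {ϖ})
    (hϖ : ϖ = 0 ∨ ϖ ∈ nonZeroDivisors R) : IsDomain R ∧ IsPrincipalIdealRing R := by
  have key (a : R) (ha : a ≠ 0) : ∃ n : ℕ, ∃ u : R, IsUnit u ∧ a = ϖ ^ n * u := by
    by_contra! H
    have h2 (n : ℕ) : ϖ ^ n ∣ a := by
      induction n with
      | zero => simp
      | succ n ih =>
        obtain ⟨u, rfl⟩ := ih
        have hu : u ∈ IsLocalRing.maximalIdeal R := fun hu ↦ H n u hu rfl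
        rw [h, Ideal.mem_span_singleton] at hu
        rw [pow_succ]
        exact mul_dvd_mul_left _ hu
    -- Krull's intersection theorem: an element divisible by every power of ϖ is zero.
    have := Ideal.iInf_pow_eq_bot_of_isLocalRing (IsLocalRing.maximalIdeal R)
      (IsLocalRing.maximalIdeal.isMaximal R).ne_top
    apply ha
    rw [← Ideal.mem_bot, ← this, Ideal.mem_iInf]
    intro n
    rw [h, Ideal.span_singleton_pow, Ideal.mem_span_singleton]
    exact h2 n
  have hpow (n : ℕ) (u : R) (hu : IsUnit u) (hn : ϖ ^ n * u ≠ 0) :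
      ϖ ^ n ∈ nonZeroDivisors R := by
    rcases hϖ with rfl | hϖ
    · rcases n with _ | n
      · simp
      · simp at hn
    · exact pow_mem hϖ n
  have hd : IsDomain R := by
    have : NoZeroDivisors R := ⟨fun {a b} hab ↦ by
      by_contra! H
      obtain ⟨n, u, hu, rfl⟩ := key a H.1
      obtain ⟨m, v, hv, rfl⟩ := key b H.2
      have h1 := mul_mem (mul_mem (hpow n u hu H.1) hu.mem_nonZeroDivisors)
        (mul_mem (hpow m v hv H.2) hv.mem_nonZeroDivisors)
      rw [hab] at h1
      exact zero_notMem_nonZeroDivisors h1⟩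
    exact NoZeroDivisors.to_isDomain R
  refine ⟨hd, ?_⟩
  have hb : ValuationRing R := by
    refine (ValuationRing.iff_dvd_total).mpr ⟨fun a b ↦ ?_⟩
    by_cases ha : a = 0
    · right; simp [ha]
    by_cases hb : b = 0
    · left; simp [hb]
    obtain ⟨n, u, hu, rfl⟩ := key a ha
    obtain ⟨m, v, hv, rfl⟩ := key b hb
    rcases le_total n m with h | h
    · left
      exact (hu.mul_right_dvd.mpr (pow_dvd_pow _ h)).trans (Dvd.intro _ rfl)
    · right
      exact (hv.mul_right_dvd.mpr (pow_dvd_pow _ h)).trans (Dvd.intro _ rfl)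
  exact (((IsBezout.TFAE (R := R)).out 0 1 :) : IsNoetherianRing R ↔ IsPrincipalIdealRing R).mp inferInstance

/-- The algebraic properties of a local ring of a smooth curve over the field `K`. -/
structure IsSmoothCurveLocalRing {K R : Type*} [CommRing K] [CommRing R] (k : K →+* R) : Prop where
  isDomain : IsDomain R
  isPrincipalIdealRing : IsPrincipalIdealRing R
  -- The derivation is ℤ-linear and kills the image of `k`, which expresses K-linearity without an
  -- algebra instance on R.
  exists_derivation : ∃ d : Derivation ℤ R R, (∀ c, d (k c) = 0) ∧
    (∀ a, IsUnramifiedElt k a ↔ IsUnit (d a)) ∧ ∃ a, IsUnit (d a)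

/-- R is unramified over the localization L of K[X] at the contracted prime, so a generator π of
that prime generates the maximal ideal of R. By flatness π stays a nonzerodivisor unless it is zero,
which is the generic case. -/
lemma isSmoothCurveLocalRing_of_etale_polynomial {K A R : Type*} [Field K] [CommRing A]
    [CommRing R] [IsLocalRing R] [Algebra K[X] A] [Algebra.Etale K[X] A] [Algebra A R]
    (q : Ideal A) [q.IsPrime] [IsLocalization.AtPrime R q] :
    IsSmoothCurveLocalRing ((algebraMap A R).comp ((algebraMap K[X] A).comp C)) := by
  let : Algebra K[X] R := ((algebraMap A R).comp (algebraMap K[X] A)).toAlgebra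
  have : IsScalarTower K[X] A R := .of_algebraMap_eq fun _ ↦ rfl
  let : Algebra K R := ((algebraMap A R).comp ((algebraMap K[X] A).comp C)).toAlgebra
  have : IsScalarTower K K[X] R := .of_algebraMap_eq fun _ ↦ rfl
  have : Algebra.FormallyEtale A R := .of_isLocalization q.primeCompl
  have : Algebra.FormallyEtale K[X] R := .comp _ A _
  let P := q.comap (algebraMap K[X] A)
  let L := Localization.AtPrime P
  let l : L →+* R := IsLocalization.lift (M := P.primeCompl) (g := algebraMap K[X] R) fun y ↦
    IsLocalization.map_units (M := q.primeCompl) R ⟨algebraMap K[X] A y, y.2⟩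
  let : Algebra L R := l.toAlgebra
  have : IsScalarTower K[X] L R := .of_algebraMap_eq fun x ↦ by
    simp [RingHom.algebraMap_toAlgebra, l]
  have : IsNoetherianRing A := Algebra.FiniteType.isNoetherianRing K[X] A
  have : IsNoetherianRing R := IsLocalization.isNoetherianRing q.primeCompl R inferInstance
  have : Algebra.FormallyUnramified L R := .of_restrictScalars K[X] L R
  have : Algebra.EssFiniteType A R := .of_isLocalization R q.primeCompl
  have : Algebra.EssFiniteType K[X] R := .comp _ A _
  have : Algebra.EssFiniteType L R := .of_comp K[X] L R
  have : Module.Flat A R := IsLocalization.flat R q.primeCompl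
  have : Module.Flat K[X] R := .trans K[X] A R
  have : IsLocalHom (algebraMap L R) := by
    refine ⟨fun x hx ↦ ?_⟩
    obtain ⟨a, s, rfl⟩ := IsLocalization.exists_mk'_eq P.primeCompl x
    have h1 : IsUnit (algebraMap A R (algebraMap K[X] A a)) := by
      have hs : IsUnit (algebraMap A R (algebraMap K[X] A s)) :=
        IsLocalization.map_units (M := q.primeCompl) R ⟨algebraMap K[X] A s, s.2⟩
      have h2 : algebraMap L R (IsLocalization.mk' L a s) * algebraMap A R (algebraMap K[X] A s) =
          algebraMap A R (algebraMap K[X] A a) := by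
        rw [← IsScalarTower.algebraMap_apply K[X] A R, ← IsScalarTower.algebraMap_apply K[X] A R,
          IsScalarTower.algebraMap_apply K[X] L R, IsScalarTower.algebraMap_apply K[X] L R,
          ← map_mul, IsLocalization.mk'_spec]
      rw [← h2]
      exact hx.mul hs
    rw [IsLocalization.AtPrime.isUnit_to_map_iff R q] at h1
    exact (IsLocalization.AtPrime.isUnit_mk'_iff L P a s).mpr h1
  obtain ⟨π, hπ⟩ := IsPrincipalIdealRing.principal P
  have hm : IsLocalRing.maximalIdeal R = Ideal.span {algebraMap K[X] R π} := by
    rw [← Algebra.FormallyUnramified.map_maximalIdeal (R := L) (S := R),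
      ← Localization.AtPrime.map_eq_maximalIdeal, Ideal.map_map,
      ← IsScalarTower.algebraMap_eq, hπ, Ideal.submodule_span_eq, Ideal.map_span,
      Set.image_singleton]
  have hreg : algebraMap K[X] R π = 0 ∨ algebraMap K[X] R π ∈ nonZeroDivisors R := by
    by_cases h0 : π = 0
    · left; simp [h0]
    · right
      have := Module.Flat.isSMulRegular_of_nonZeroDivisors (M := R)
        (mem_nonZeroDivisors_of_ne_zero h0)
      rw [mem_nonZeroDivisors_iff_right]
      intro x hx
      exact this (by simpa [Algebra.smul_def, mul_comm] using hx)
  obtain ⟨h1, h2⟩ := isDomain_and_isPrincipalIdealRing_of_maximalIdeal_eq_span _ hm hreg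
  obtain ⟨d, hd, a, ha⟩ := exists_derivation_of_formallyEtale (K := K) (R := R)
  exact ⟨h1, h2, d.restrictScalars ℤ, fun c ↦ d.map_algebraMap c, hd, a, ha⟩

lemma isSmoothCurveLocalRing_of_isStandardSmooth {K A R : Type u} [Field K] [CommRing A]
    [CommRing R] [IsLocalRing R] (k : K →+* A) (hk : k.IsStandardSmoothOfRelativeDimension 1)
    [Algebra A R] (q : Ideal A) [q.IsPrime] [IsLocalization.AtPrime R q] :
    IsSmoothCurveLocalRing ((algebraMap A R).comp k) := by
  obtain ⟨g, rfl, hg⟩ := hk.exists_etale_mvPolynomial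
  let e : K[X] ≃ₐ[K] MvPolynomial (Fin 1) K :=
    (MvPolynomial.uniqueAlgEquiv K (Fin 1)).symm
  let : Algebra K[X] A := (g.comp e.toRingEquiv.toRingHom).toAlgebra
  have : Algebra.Etale K[X] A := RingHom.Etale.toAlgebra <|
    RingHom.Etale.stableUnderComposition e.toRingEquiv.toRingHom g
      (RingHom.Etale.of_bijective e.bijective) hg
  have := isSmoothCurveLocalRing_of_etale_polynomial (K := K) (A := A) (R := R) q
  convert! this using 2
  ext x
  simp [RingHom.algebraMap_toAlgebra, e]

end Algebra
end BelyiCharP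

/-! ### Calculus of unramified elements -/

namespace BelyiCharP

section Algebra

open Polynomial IsLocalRing

namespace IsSmoothCurveLocalRing

variable {K R : Type*} [Field K] [CommRing R] [IsLocalRing R] {k : K →+* R}

/-- By the Leibniz rule a derivation maps 𝔪² into 𝔪, so being unramified depends only on the class
modulo 𝔪². -/
lemma isUnramifiedElt_of_sub_mem (h : IsSmoothCurveLocalRing k) {a b : R}
    (ha : IsUnramifiedElt k a) (hab : a - b ∈ maximalIdeal R ^ 2) : IsUnramifiedElt k b := by
  obtain ⟨d, -, hd, -⟩ := h.exists_derivation
  rw [hd] at ha ⊢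
  have hmem : d (a - b) ∈ maximalIdeal R := by
    generalize a - b = c at hab
    rw [pow_two] at hab
    induction hab using Submodule.mul_induction_on' with
    | mem_mul_mem x hx y hy =>
      rw [Derivation.leibniz]
      exact add_mem (Ideal.mul_mem_right _ _ hx) (Ideal.mul_mem_right _ _ hy)
    | add x _ y _ hx hy => rw [map_add]; exact add_mem hx hy
  by_contra hb
  rw [← mem_nonunits_iff, ← mem_maximalIdeal] at hb
  rw [map_sub] at hmem
  exact (mem_maximalIdeal _).mp (by simpa using add_mem hmem hb) ha

lemma not_isUnramifiedElt_of_mem (h : IsSmoothCurveLocalRing k) {a : R}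
    (ha : a ∈ maximalIdeal R ^ 2) : ¬ IsUnramifiedElt k a := by
  intro h'
  have h0 := h.isUnramifiedElt_of_sub_mem (b := 0) h' (by simpa using ha)
  obtain ⟨d, -, hd, -⟩ := h.exists_derivation
  simp [hd] at h0

omit [IsLocalRing R] in
-- This is where characteristic p enters: d(bᵖ) = p bᵖ⁻¹ db = 0.
lemma isUnramifiedElt_add_pow (h : IsSmoothCurveLocalRing k) (p : ℕ) [CharP K p] {a : R}
    (ha : IsUnramifiedElt k a) (b : R) : IsUnramifiedElt k (a + b ^ p) := by
  obtain ⟨d, -, hd, -⟩ := h.exists_derivation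
  have hp : (p : R) = 0 := by rw [← map_natCast k, CharP.cast_eq_zero, map_zero]
  rw [hd] at ha ⊢
  rw [map_add, Derivation.leibniz_pow, ← Nat.cast_smul_eq_nsmul R, hp]
  simpa using ha

omit [IsLocalRing R] in
lemma exists_isUnramifiedElt (h : IsSmoothCurveLocalRing k) : ∃ a, IsUnramifiedElt k a := by
  obtain ⟨d, -, hd, a, ha⟩ := h.exists_derivation
  exact ⟨a, (hd a).mpr ha⟩

/-- Unramified elements are transcendental. -/
lemma eval₂_ne_zero_of_isUnramifiedElt [PerfectField K] (h : IsSmoothCurveLocalRing k) {a : R}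
    (ha : IsUnramifiedElt k a) {q : K[X]} (hq : q ≠ 0) : q.eval₂ k a ≠ 0 := by
  obtain ⟨d, hk, hd, -⟩ := h.exists_derivation
  rw [hd] at ha
  have hder (q : K[X]) : d (q.eval₂ k a) = q.derivative.eval₂ k a * d a := by
    induction q using Polynomial.induction_on' with
    | add q r hq hr => simp [eval₂_add, hq, hr, add_mul]
    | monomial n c =>
      rw [eval₂_monomial, Derivation.leibniz, hk, Derivation.leibniz_pow, derivative_monomial,
        eval₂_monomial]
      simp
      ring
  have := h.isDomain
  intro h0
  -- Were a algebraic, differentiating its minimal polynomial m would give m'(a)·da = 0, so m'(a) =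
  -- 0, against separability of m over a perfect field.
  let : Algebra K R := k.toAlgebra
  have hint : IsIntegral K a := isAlgebraic_iff_isIntegral.mp ⟨q, hq, h0⟩
  obtain ⟨u, v, huv⟩ := PerfectField.separable_of_irreducible (minpoly.irreducible hint)
  have h1 := hder (minpoly K a)
  rw [show (minpoly K a).eval₂ k a = 0 from minpoly.aeval K a, map_zero] at h1
  have h2 := congrArg (eval₂ k a) huv
  rw [eval₂_add, eval₂_mul, eval₂_mul, show (minpoly K a).eval₂ k a = 0 from minpoly.aeval K a,
    (mul_eq_zero.mp h1.symm).resolve_right ha.ne_zero] at h2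
  simp at h2

/-- If the residue field is algebraic over `K`, then `R` is not a field. -/
lemma maximalIdeal_ne_bot [PerfectField K] (h : IsSmoothCurveLocalRing k)
    (halg : ∀ a : R, ∃ q : K[X], q ≠ 0 ∧ q.eval₂ k a ∈ maximalIdeal R) : maximalIdeal R ≠ ⊥ := by
  intro hbot
  obtain ⟨a, ha⟩ := h.exists_isUnramifiedElt
  obtain ⟨q, hq, hqa⟩ := halg a
  rw [hbot, Ideal.mem_bot] at hqa
  exact h.eval₂_ne_zero_of_isUnramifiedElt ha hq hqa

lemma eq_bot_or_eq_maximalIdeal (h : IsSmoothCurveLocalRing k) (P : Ideal R) [P.IsPrime] :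
    P = ⊥ ∨ P = maximalIdeal R := by
  have := h.isDomain
  have := h.isPrincipalIdealRing
  by_cases hP : P = ⊥
  · exact .inl hP
  · exact .inr (eq_maximalIdeal (Ring.DimensionLEOne.maximalOfPrime hP ‹_›))

section Dichotomy

variable {F : Type*} [Field F] [Algebra R F]

/-- With gh = c one has g + h⁻ᵖ = h⁻ᵖ(1 + c hᵖ⁻¹), and the bracket is a unit since h ∈ 𝔪. The
witness is w = hᵖ(1 + c hᵖ⁻¹)⁻¹, which lies in 𝔪² because p ≥ 2. -/
lemma exists_inverse_mem_sq (p : ℕ) (hp : 2 ≤ p) {g : F} {h c : R}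
    (hh : h ∈ maximalIdeal R) (hh0 : algebraMap R F h ≠ 0)
    (hc : g * algebraMap R F h = algebraMap R F c) :
    ∃ w ∈ maximalIdeal R ^ 2, algebraMap R F w * (g + (algebraMap R F h)⁻¹ ^ p) = 1 := by
  have hu : IsUnit (1 + c * h ^ (p - 1)) := by
    by_contra hu
    rw [← mem_nonunits_iff, ← mem_maximalIdeal] at hu
    have h1 : c * h ^ (p - 1) ∈ maximalIdeal R :=
      Ideal.mul_mem_left _ _ (Ideal.pow_mem_of_mem _ hh _ (by lia))
    exact (Ideal.ne_top_iff_one _).mp (maximalIdeal.isMaximal R).ne_top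
      (by simpa using sub_mem hu h1)
  obtain ⟨u, hu⟩ := hu
  refine ⟨h ^ p * ↑u⁻¹, Ideal.mul_mem_right _ _ (Ideal.pow_le_pow_right hp
    (Ideal.pow_mem_pow hh p)), ?_⟩
  have h1 : algebraMap R F u * algebraMap R F ↑u⁻¹ = 1 := by rw [← map_mul]; simp
  have h2 : algebraMap R F u = 1 + g * algebraMap R F h ^ p := by
    obtain ⟨n, rfl⟩ : ∃ n, p = n + 1 := ⟨p - 1, by lia⟩
    rw [hu, map_add, map_mul, ← hc, map_one, map_pow, Nat.add_sub_cancel]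
    ring
  have h3 : algebraMap R F h ^ p * (g + (algebraMap R F h)⁻¹ ^ p) = algebraMap R F u := by
    rw [h2, mul_add, inv_pow, mul_inv_cancel₀ (pow_ne_zero p hh0)]
    ring
  rw [map_mul, map_pow, mul_right_comm, h3, h1]

/-- R is a valuation ring, so h or h⁻¹ lies in R. If h⁻¹ does, a p-th power of R is added to a;
otherwise h ∈ 𝔪 and the sum has a multiple pole. -/
lemma isUnramifiedElt_or_exists_inverse (hR : IsSmoothCurveLocalRing k) [IsFractionRing R F]
    (p : ℕ) [CharP K p] (hp : 2 ≤ p) {a : R} (ha : IsUnramifiedElt k a) {h : F} (hh : h ≠ 0) :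
    (∃ b, IsUnramifiedElt k b ∧ algebraMap R F b = algebraMap R F a + h⁻¹ ^ p) ∨
    ∃ w ∈ maximalIdeal R ^ 2, algebraMap R F w * (algebraMap R F a + h⁻¹ ^ p) = 1 := by
  have := hR.isDomain
  have := hR.isPrincipalIdealRing
  rcases ValuationRing.isInteger_or_isInteger R h with ⟨x, rfl⟩ | ⟨x, hx⟩
  · by_cases hxu : IsUnit x
    · left
      obtain ⟨u, rfl⟩ := hxu
      refine ⟨a + ↑u⁻¹ ^ p, hR.isUnramifiedElt_add_pow p ha _, ?_⟩
      have : (algebraMap R F u)⁻¹ = algebraMap R F ↑u⁻¹ :=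
        inv_eq_of_mul_eq_one_right (by rw [← map_mul]; simp)
      rw [this, map_add, map_pow]
    · right
      exact exists_inverse_mem_sq p hp ((mem_maximalIdeal x).mpr hxu) hh (c := a * x) (by simp)
  · left
    exact ⟨a + x ^ p, hR.isUnramifiedElt_add_pow p ha _, by rw [map_add, map_pow, hx]⟩

end Dichotomy

end IsSmoothCurveLocalRing

end Algebra

end BelyiCharP

noncomputable section

namespace BelyiCharP

attribute [local instance] MvPolynomial.gradedAlgebra

/-! ### Coordinate rings of the standard charts of ℙ¹ -/

section ProjectiveLine

open MvPolynomial HomogeneousLocalization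

/-- The grading of `K[X₀, X₁]`. -/
abbrev binaryGrading (K : Type u) [Field K] : ℕ → Submodule K (MvPolynomial (Fin (1 + 1)) K) :=
  homogeneousSubmodule (Fin (1 + 1)) K

lemma X_mem_binaryGrading (K : Type u) [Field K] (i : Fin (1 + 1)) : X i ∈ binaryGrading K 1 :=
  isHomogeneous_X K i

lemma eval₂_smul_of_isHomogeneous {K R σ : Type*} [CommSemiring K] [CommSemiring R] (k : K →+* R)
    (c : R) (v : σ → R) {P : MvPolynomial σ K} {n : ℕ} (hP : P.IsHomogeneous n) :
    eval₂ k (fun i ↦ c * v i) P = c ^ n * eval₂ k v P := by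
  rw [eval₂_eq, eval₂_eq, Finset.mul_sum]
  refine Finset.sum_congr rfl fun d hd ↦ ?_
  have h1 : ∑ i ∈ d.support, d i = n := by
    have := hP (mem_support_iff.mp hd)
    simpa [Finsupp.weight_apply, Finsupp.sum] using this
  simp_rw [mul_pow]
  rw [Finset.prod_mul_distrib, Finset.prod_pow_eq_pow_sum, h1]
  ring

variable {K : Type u} [Field K] {R S : Type u} [CommRing R] [CommRing S] (k : K →+* R)
  (v : Fin (1 + 1) → R)

/-- The evaluation at `v` of homogeneous fractions of degree zero with denominator a power
of `P`. -/
def evalAway (P : MvPolynomial (Fin (1 + 1)) K) (hP : IsUnit (eval₂Hom k v P)) :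
    Away (binaryGrading K) P →+* R :=
  (IsLocalization.Away.lift (S := Localization.Away P) P hP).comp
    (algebraMap (Away (binaryGrading K) P) (Localization.Away P))

lemma evalAway_mk {P : MvPolynomial (Fin (1 + 1)) K} (hP : IsUnit (eval₂Hom k v P)) {d : ℕ}
    (hd : P ∈ binaryGrading K d) (n : ℕ) (Q : MvPolynomial (Fin (1 + 1)) K)
    (hQ : Q ∈ binaryGrading K (n • d)) :
    evalAway k v P hP (Away.mk _ hd n Q hQ) * eval₂ k v P ^ n = eval₂ k v Q := by
  have h1 : (Localization.mk Q ⟨P ^ n, n, rfl⟩ : Localization.Away P) *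
      algebraMap _ _ (P ^ n) = algebraMap _ _ Q := by
    rw [← Localization.mk_one_eq_algebraMap, ← Localization.mk_one_eq_algebraMap,
      Localization.mk_mul, Localization.mk_eq_mk_iff, Localization.r_iff_exists]
    exact ⟨1, by simp; ring⟩
  have h2 := congrArg (IsLocalization.Away.lift (S := Localization.Away P) P hP) h1
  rw [map_mul, IsLocalization.Away.lift_eq, IsLocalization.Away.lift_eq, map_pow] at h2
  exact h2

/-- As P(v) is a unit, clearing denominators determines the map. The identities between evaluation
maps below reduce to this. -/
lemma evalAway_ext {P : MvPolynomial (Fin (1 + 1)) K} (hP : IsUnit (eval₂Hom k v P)) {d : ℕ}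
    (hd : P ∈ binaryGrading K d) (f : Away (binaryGrading K) P →+* R)
    (hf : ∀ n Q hQ, f (Away.mk _ hd n Q hQ) * eval₂ k v P ^ n = eval₂ k v Q) :
    f = evalAway k v P hP := by
  ext x
  obtain ⟨n, Q, hQ, rfl⟩ := Away.mk_surjective (binaryGrading K) hd x
  exact (hP.pow n).mul_left_injective ((hf n Q hQ).trans (evalAway_mk k v hP hd n Q hQ).symm)

lemma comp_evalAway {P : MvPolynomial (Fin (1 + 1)) K} (hP : IsUnit (eval₂Hom k v P)) {d : ℕ}
    (hd : P ∈ binaryGrading K d) (φ : R →+* S) (hP') :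
    φ.comp (evalAway k v P hP) = evalAway (φ.comp k) (φ ∘ v) P hP' := by
  refine evalAway_ext _ _ _ hd _ fun n Q hQ ↦ ?_
  have (Q : MvPolynomial (Fin (1 + 1)) K) : eval₂ (φ.comp k) (φ ∘ v) Q = φ (eval₂ k v Q) := by
    rw [eval₂_comp_left]
  rw [this, this, RingHom.comp_apply, ← map_pow, ← map_mul, evalAway_mk]

lemma evalAway_mul_comp_awayMap {P Q : MvPolynomial (Fin (1 + 1)) K} {d e : ℕ}
    (hd : P ∈ binaryGrading K d) (he : Q ∈ binaryGrading K e) (hP : IsUnit (eval₂Hom k v P))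
    {P' : MvPolynomial (Fin (1 + 1)) K} (h : P' = P * Q) (hP' : IsUnit (eval₂Hom k v P')) :
    (evalAway k v P' hP').comp (awayMap (binaryGrading K) he h) = evalAway k v P hP := by
  refine evalAway_ext _ _ _ hd _ fun n A hA ↦ ?_
  have h1 : awayMap (binaryGrading K) he h (Away.mk _ hd n A hA) =
      Away.mk _ (h ▸ SetLike.mul_mem_graded hd he) n (A * Q ^ n) (by
        rw [smul_add]; exact SetLike.mul_mem_graded hA (SetLike.pow_mem_graded n he)) := by
    ext
    rw [Away.mk, val_awayMap_mk, Away.val_mk]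
  have h2 := evalAway_mk k v hP' (h ▸ SetLike.mul_mem_graded hd he) n (A * Q ^ n) (by
        rw [smul_add]; exact SetLike.mul_mem_graded hA (SetLike.pow_mem_graded n he))
  rw [RingHom.comp_apply, h1]
  have hQ : IsUnit (eval₂ k v Q ^ n) := by
    rw [h, map_mul] at hP'
    exact (isUnit_of_mul_isUnit_right hP').pow n
  apply hQ.mul_left_injective
  simp only
  rw [eval₂_mul, eval₂_pow] at h2
  have h3 : eval₂ k v P' = eval₂ k v P * eval₂ k v Q := by rw [h, eval₂_mul]
  rw [← h2, h3, mul_pow, mul_assoc]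

lemma evalAway_smul {P : MvPolynomial (Fin (1 + 1)) K} (hP : IsUnit (eval₂Hom k v P)) {d : ℕ}
    (hd : P ∈ binaryGrading K d) (c : R) (hP' : IsUnit (eval₂Hom k (fun i ↦ c * v i) P)) :
    evalAway k v P hP = evalAway k (fun i ↦ c * v i) P hP' := by
  refine evalAway_ext _ _ _ hd _ fun n Q hQ ↦ ?_
  rw [eval₂_smul_of_isHomogeneous k c v hd, eval₂_smul_of_isHomogeneous k c v hQ,
    ← evalAway_mk k v hP hd n Q hQ]
  rw [smul_eq_mul, mul_pow, ← pow_mul, mul_comm n d]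
  ring

lemma evalAway_fromZeroRingHom {P : MvPolynomial (Fin (1 + 1)) K}
    (hP : IsUnit (eval₂Hom k v P)) {d : ℕ} (hd : P ∈ binaryGrading K d) :
    (evalAway k v P hP).comp ((fromZeroRingHom (binaryGrading K) _).comp
      (algebraMap K (binaryGrading K 0))) = k := by
  ext c
  have h1 : fromZeroRingHom (binaryGrading K) (Submonoid.powers P)
      (algebraMap K (binaryGrading K 0) c) = Away.mk _ hd 0 (C c) (by
        rw [zero_smul]; exact isHomogeneous_C _ _) := by
    ext
    simp [fromZeroRingHom]
    rfl
  have h2 := evalAway_mk k v hP hd 0 (C c) (by rw [zero_smul]; exact isHomogeneous_C _ _)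
  rw [RingHom.comp_apply, RingHom.comp_apply, h1]
  simpa using h2

/-- The coordinate `X j / X i` on the open set where `X i` does not vanish. -/
abbrev awayCoord (K : Type u) [Field K] (i j : Fin (1 + 1)) :
    Away (binaryGrading K) (X i : MvPolynomial (Fin (1 + 1)) K) :=
  Away.isLocalizationElem (X_mem_binaryGrading K i) (X_mem_binaryGrading K j)

lemma evalAway_awayCoord (i j : Fin (1 + 1)) (hP : IsUnit (eval₂Hom k v (X i))) :
    evalAway k v (X i) hP (awayCoord K i j) * v i = v j := by
  have := evalAway_mk k v hP (X_mem_binaryGrading K i) 1 (X j ^ 1)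
    (by simpa using X_mem_binaryGrading K j)
  have h1 : eval₂ k v (X i) ^ 1 = v i := by simp
  have h2 : eval₂ k v (X j ^ 1) = v j := by simp
  rw [h1, h2] at this
  exact this

/-- Dehomogenization: Q / Xᵢⁿ = Q(X₀/Xᵢ, X₁/Xᵢ) for Q homogeneous of degree n. -/
lemma eval₂_awayCoord (i : Fin (1 + 1)) (n : ℕ) (Q : MvPolynomial (Fin (1 + 1)) K)
    (hQ : Q ∈ binaryGrading K (n • 1)) :
    eval₂ ((fromZeroRingHom (binaryGrading K) _).comp (algebraMap K (binaryGrading K 0)))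
      (awayCoord K i) Q = Away.mk _ (X_mem_binaryGrading K i) n Q hQ := by
  apply val_injective
  rw [smul_eq_mul, mul_one] at hQ
  change algebraMap (Away (binaryGrading K) (X i : MvPolynomial (Fin (1 + 1)) K))
    (Localization.Away (X i : MvPolynomial (Fin (1 + 1)) K)) _ = _
  rw [eval₂_comp_left]
  let c : Localization.Away (X i : MvPolynomial (Fin (1 + 1)) K) :=
    Localization.mk 1 ⟨X i, 1, pow_one _⟩
  have h1 : (algebraMap (Away (binaryGrading K) (X i : MvPolynomial (Fin (1 + 1)) K))
      (Localization.Away (X i : MvPolynomial (Fin (1 + 1)) K))) ∘ awayCoord K i =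
      fun j ↦ c * algebraMap (MvPolynomial (Fin (1 + 1)) K) _ (X j) := by
    funext j
    simp only [Function.comp_apply, c, ← Localization.mk_one_eq_algebraMap, Localization.mk_mul]
    change Localization.mk (X j ^ 1)
      (⟨X i ^ 1, 1, rfl⟩ : Submonoid.powers (X i : MvPolynomial (Fin (1 + 1)) K)) = _
    simp
  have h2 : (algebraMap (Away (binaryGrading K) (X i : MvPolynomial (Fin (1 + 1)) K))
      (Localization.Away (X i : MvPolynomial (Fin (1 + 1)) K))).comp
      ((fromZeroRingHom (binaryGrading K) _).comp (algebraMap K (binaryGrading K 0))) =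
      (algebraMap (MvPolynomial (Fin (1 + 1)) K) _).comp C := by
    ext a
    rfl
  rw [h1, h2, eval₂_smul_of_isHomogeneous _ _ _ hQ]
  have h3 : eval₂ ((algebraMap (MvPolynomial (Fin (1 + 1)) K)
      (Localization.Away (X i : MvPolynomial (Fin (1 + 1)) K))).comp C)
      (fun j ↦ algebraMap (MvPolynomial (Fin (1 + 1)) K) _ (X j)) Q = algebraMap _ _ Q := by
    conv_rhs => rw [← eval₂_eta Q, eval₂_comp_left]
    rfl
  rw [h3]
  change _ = Localization.mk Q
    (⟨X i ^ n, n, rfl⟩ : Submonoid.powers (X i : MvPolynomial (Fin (1 + 1)) K))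
  rw [← Localization.mk_one_eq_algebraMap, Localization.mk_pow,
    Localization.mk_mul]
  simp
  rfl

/-- The degree zero part of `K[X₀, X₁]` localized at `X i` is a quotient of `K[t]`. -/
lemma surjective_eval₂RingHom_awayCoord {i j : Fin (1 + 1)} (hij : i ≠ j) :
    Function.Surjective (Polynomial.eval₂RingHom ((fromZeroRingHom (binaryGrading K)
      (Submonoid.powers (X i))).comp (algebraMap K (binaryGrading K 0))) (awayCoord K i j)) := by
  intro x
  obtain ⟨n, Q, hQ, rfl⟩ := Away.mk_surjective (binaryGrading K) (X_mem_binaryGrading K i) x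
  refine ⟨eval₂ Polynomial.C (fun m ↦ if m = i then 1 else Polynomial.X) Q, ?_⟩
  rw [← eval₂_awayCoord, eval₂_comp_left]
  congr 1
  · ext; simp
  · funext m
    by_cases hm : m = i
    · subst hm
      have h1 : awayCoord K m m = 1 := by
        apply val_injective
        rw [val_one, ← Localization.mk_self (⟨X m ^ 1, 1, rfl⟩ : Submonoid.powers (X m))]
        rfl
      simp [h1]
    · obtain rfl : m = j := by lia
      simp [hm]

lemma evalAway_comp_eval₂RingHom (i j : Fin (1 + 1)) (hv : v i = 1)
    (hP : IsUnit (eval₂Hom k v (X i))) :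
    (evalAway k v (X i) hP).comp (Polynomial.eval₂RingHom ((fromZeroRingHom (binaryGrading K)
      (Submonoid.powers (X i))).comp (algebraMap K (binaryGrading K 0))) (awayCoord K i j)) =
      Polynomial.eval₂RingHom k (v j) := by
  ext a
  · have := RingHom.congr_fun (evalAway_fromZeroRingHom k v hP (X_mem_binaryGrading K i)) a
    simpa using this
  · have := evalAway_awayCoord k v i j hP
    simpa [hv] using this

/-- Precomposing with the surjection from K[t] does not affect formal unramifiedness. -/
lemma evalAway_formallyUnramified_iff {i j : Fin (1 + 1)} (hij : i ≠ j) (hv : v i = 1)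
    (hP : IsUnit (eval₂Hom k v (X i))) :
    (evalAway k v (X i) hP).FormallyUnramified ↔ IsUnramifiedElt k (v j) := by
  rw [IsUnramifiedElt, ← evalAway_comp_eval₂RingHom k v i j hv hP]
  exact ⟨fun h' ↦ .comp (.of_surjective (surjective_eval₂RingHom_awayCoord hij)) h',
    fun h' ↦ .of_comp h'⟩

end ProjectiveLine

end BelyiCharP

end

noncomputable section

namespace BelyiCharP

attribute [local instance] MvPolynomial.gradedAlgebra

/-! ### Gluing morphisms given on local rings -/

section Spreading

open Scheme

lemma fromFunctionField_eq_fromSpecStalkOfMem {X Y : Scheme.{u}} [IrreducibleSpace X]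
    (f : X.PartialMap Y) {x : X} (hx : x ∈ f.domain) :
    f.fromFunctionField = Spec.map (X.presheaf.stalkSpecializes (genericPoint_specializes x)) ≫
      f.fromSpecStalkOfMem hx := by
  simp only [PartialMap.fromFunctionField, PartialMap.fromSpecStalkOfMem, ← Category.assoc]
  congr 1
  rw [← cancel_mono f.domain.ι]
  simp

/-- Compatible morphisms out of the spectra of all local rings of an integral scheme glue. -/
lemma exists_hom_of_fromSpecStalk {X Y S : Scheme.{u}} [IsIntegral X] [Y.IsSeparated]
    [S.IsSeparated] (sX : X ⟶ S) (sY : Y ⟶ S) [LocallyOfFiniteType sY]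
    (ψ : ∀ x : X, Spec (X.presheaf.stalk x) ⟶ Y)
    (h : ∀ x, ψ x ≫ sY = X.fromSpecStalk x ≫ sX) (ψ₀ : Spec X.functionField ⟶ Y)
    (hψ : ∀ x, Spec.map (X.presheaf.stalkSpecializes (genericPoint_specializes x)) ≫ ψ x = ψ₀) :
    ∃ φ : X ⟶ Y, φ ≫ sY = sX ∧ ∀ x, X.fromSpecStalk x ≫ φ = ψ x := by
  -- Each germ spreads out to a neighbourhood. The resulting partial maps agree at the generic
  -- point, so they represent one rational map, whose maximal domain contains every x.
  let g (x : X) : X.PartialMap Y := PartialMap.ofFromSpecStalk sX sY (ψ x) (h x)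
  have hg (x : X) : x ∈ (g x).domain := PartialMap.mem_domain_ofFromSpecStalk sX sY (ψ x) (h x)
  have hgψ (x : X) : (g x).fromSpecStalkOfMem (hg x) = ψ x :=
    PartialMap.fromSpecStalkOfMem_ofFromSpecStalk sX sY (ψ x) (h x)
  let r : X.RationalMap Y := (g (genericPoint X)).toRationalMap
  have hr (x : X) : (g x).toRationalMap = r := by
    apply RationalMap.eq_of_fromFunctionField_eq
    rw [RationalMap.fromFunctionField_toRationalMap, RationalMap.fromFunctionField_toRationalMap,
      fromFunctionField_eq_fromSpecStalkOfMem _ (hg x),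
      fromFunctionField_eq_fromSpecStalkOfMem _ (hg _), hgψ, hgψ, hψ, hψ]
  have hle (x : X) : (g x).domain ≤ r.toPartialMap.domain := by
    rw [← hr x]
    exact (g x).le_domain_toRationalMap
  have htop : r.toPartialMap.domain = ⊤ := top_le_iff.mp fun x _ ↦ hle x (hg x)
  let φ : X ⟶ Y := X.topIso.inv ≫ (X.isoOfEq htop).inv ≫ r.toPartialMap.hom
  have hφ (x : X) : X.fromSpecStalk x ≫ φ = ψ x := by
    have h1 : (r.toPartialMap.restrict _ (g x).dense_domain (hle x)).hom = (g x).hom := by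
      have (r' : X.RationalMap Y) (hr' : (g x).toRationalMap = r') (hle') :
          (r'.toPartialMap.restrict _ (g x).dense_domain hle').hom = (g x).hom := by
        subst hr'
        exact (g x).toPartialMap_toRationalMap_restrict
      exact this r (hr x) (hle x)
    rw [← hgψ x, PartialMap.fromSpecStalkOfMem, ← h1, PartialMap.restrict_hom, ← Category.assoc,
      ← Category.assoc, ← Category.assoc]
    congr 1
    rw [← cancel_mono r.toPartialMap.domain.ι]
    simp
  refine ⟨φ, ?_, hφ⟩
  -- Compatibility with the maps to S can be tested at the generic point, since X is reduced and S
  -- is separated.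
  have : IsDominant (X.fromSpecStalk (genericPoint X)) := by
    refine ⟨(dense_iff_closure_eq.mpr (genericPoint_closure (α := X))).mono ?_⟩
    rw [Set.singleton_subset_iff, range_fromSpecStalk]
    exact specializes_rfl
  refine ext_of_isDominant (X.fromSpecStalk (genericPoint X)) ?_
  rw [reassoc_of% (hφ (genericPoint X)), h]

end Spreading

/-! ### Points of ℙ¹ in homogeneous coordinates -/

section Charts

open MvPolynomial HomogeneousLocalization

variable {K : Type u} [Field K] {R S : Type u} [CommRing R] [CommRing S] (k : K →+* R)
  (v : Fin (1 + 1) → R)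

/-- The open immersion of the locus where `X i` does not vanish into the projective line. -/
abbrev chart (K : Type u) [Field K] (i : Fin (1 + 1)) :
    Spec (CommRingCat.of (Away (binaryGrading K) (X i))) ⟶ ProjSpace 1 K :=
  Proj.awayι (binaryGrading K) (X i) (X_mem_binaryGrading K i) one_pos

/-- The point of the projective line with homogeneous coordinates `v`, one of which is a unit. -/
def toProjLine (i : Fin (1 + 1)) (hi : IsUnit (v i)) : Spec (CommRingCat.of R) ⟶ ProjSpace 1 K :=
  Spec.map (CommRingCat.ofHom (evalAway k v (X i) (by simpa using hi))) ≫ chart K i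

lemma toProjLine_toSpec (i : Fin (1 + 1)) (hi : IsUnit (v i)) :
    toProjLine k v i hi ≫ ProjSpace.toSpec 1 K = Spec.map (CommRingCat.ofHom k) := by
  rw [toProjLine, chart, ProjSpace.toSpec, Category.assoc, Proj.awayι_toSpecZero_assoc, ← Spec.map_comp,
    ← Spec.map_comp, ← CommRingCat.ofHom_comp, ← CommRingCat.ofHom_comp,
    evalAway_fromZeroRingHom _ _ _ (X_mem_binaryGrading K i)]

lemma specMap_toProjLine (φ : R →+* S) (i : Fin (1 + 1)) (hi : IsUnit (v i)) :
    Spec.map (CommRingCat.ofHom φ) ≫ toProjLine k v i hi =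
      toProjLine (φ.comp k) (φ ∘ v) i (hi.map φ) := by
  rw [toProjLine, ← Category.assoc, ← Spec.map_comp, ← CommRingCat.ofHom_comp,
    comp_evalAway _ _ _ (X_mem_binaryGrading K i), toProjLine]

/-- Both sides factor through the overlap where XᵢXⱼ does not vanish. -/
lemma toProjLine_eq (i j : Fin (1 + 1)) (hi : IsUnit (v i)) (hj : IsUnit (v j)) :
    toProjLine k v i hi = toProjLine k v j hj := by
  have h : IsUnit (eval₂Hom k v (X i * X j)) := by simpa using ⟨hi, hj⟩
  rw [toProjLine, toProjLine,
    ← evalAway_mul_comp_awayMap k v (X_mem_binaryGrading K i) (X_mem_binaryGrading K j) _ rfl h,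
    ← evalAway_mul_comp_awayMap k v (X_mem_binaryGrading K j) (X_mem_binaryGrading K i) _
      (mul_comm (X i) (X j)) h, CommRingCat.ofHom_comp, CommRingCat.ofHom_comp, Spec.map_comp,
    Spec.map_comp, Category.assoc, Category.assoc, chart, chart, Proj.SpecMap_awayMap_awayι,
    Proj.SpecMap_awayMap_awayι]

lemma toProjLine_smul (i j : Fin (1 + 1)) (hi : IsUnit (v i)) (c : R) (w : Fin (1 + 1) → R)
    (hw : w = fun i ↦ c * v i) (hj : IsUnit (w j)) :
    toProjLine k v i hi = toProjLine k w j hj := by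
  subst hw
  rw [toProjLine_eq k _ i j hi (isUnit_of_mul_isUnit_right hj), toProjLine, toProjLine,
    evalAway_smul k v _ (X_mem_binaryGrading K j)]

lemma toProjLine_preimage_basicOpen (i j : Fin (1 + 1)) (hi : IsUnit (v i)) :
    toProjLine k v i hi ⁻¹ᵁ Proj.basicOpen (binaryGrading K) (X j) =
      PrimeSpectrum.basicOpen (v j) := by
  rw [toProjLine, chart, Scheme.Hom.comp_preimage, Proj.awayι_preimage_basicOpen _ _ _ (hm' := one_pos)]
  have := evalAway_awayCoord k v i j (by simpa using hi)
  rw [← this]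
  ext x
  change x ∈ PrimeSpectrum.basicOpen (evalAway k v (X i) _ (awayCoord K i j)) ↔ _
  have h2 : PrimeSpectrum.basicOpen (v i) = ⊤ := by
    ext y
    simpa using fun h ↦ y.2.ne_top (Ideal.eq_top_of_isUnit_mem _ h hi)
  rw [PrimeSpectrum.basicOpen_mul, h2, inf_top_eq]
  rfl

lemma exists_eq_toProjLine (i : Fin (1 + 1)) (ψ : Spec (CommRingCat.of R) ⟶ ProjSpace 1 K)
    (hk : ψ ≫ ProjSpace.toSpec 1 K = Spec.map (CommRingCat.ofHom k))
    (hψ : Set.range ψ ⊆ Proj.basicOpen (binaryGrading K) (X i)) :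
    ∃ (v : Fin (1 + 1) → R) (hi : v i = 1), ψ = toProjLine k v i (hi ▸ isUnit_one) := by
  have hr : Set.range ψ ⊆ Set.range (chart K i) := by
    rwa [← Scheme.Hom.coe_opensRange (chart K i), Proj.opensRange_awayι]
  obtain ⟨f, hf⟩ := Spec.map_surjective (IsOpenImmersion.lift (chart K i) ψ hr)
  have hψf : Spec.map f ≫ chart K i = ψ := by rw [hf, IsOpenImmersion.lift_fac]
  have hfk : f.hom.comp ((fromZeroRingHom (binaryGrading K) _).comp
      (algebraMap K (binaryGrading K 0))) = k := by
    rw [← hψf, chart, ProjSpace.toSpec, Category.assoc, Proj.awayι_toSpecZero_assoc,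
      ← Spec.map_comp, ← Spec.map_comp, ← CommRingCat.ofHom_comp] at hk
    exact congrArg CommRingCat.Hom.hom (Spec.map_injective hk)
  have h1 : awayCoord K i i = 1 := by
    apply val_injective
    rw [val_one, ← Localization.mk_self (⟨X i ^ 1, 1, rfl⟩ : Submonoid.powers (X i))]
    rfl
  refine ⟨fun j ↦ f.hom (awayCoord K i j), by simp only [h1, map_one], ?_⟩
  rw [← hψf, toProjLine]
  congr 2
  ext1
  refine evalAway_ext _ _ _ (X_mem_binaryGrading K i) _ fun n Q hQ ↦ ?_
  rw [← eval₂_awayCoord, eval₂_comp_left, hfk, eval₂_X, h1, map_one, one_pow, mul_one]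
  rfl

lemma mem_basicOpen_iff_isUnit {X : Scheme.{u}} (φ : X ⟶ ProjSpace 1 K) (x : X)
    (k : K →+* X.presheaf.stalk x) (v : Fin (1 + 1) → X.presheaf.stalk x) (i j : Fin (1 + 1))
    (hi : IsUnit (v i)) (h : X.fromSpecStalk x ≫ φ = toProjLine k v i hi) :
    φ x ∈ Proj.basicOpen (binaryGrading K) (MvPolynomial.X j) ↔ IsUnit (v j) := by
  have h1 := toProjLine_preimage_basicOpen k v i j hi
  rw [← h] at h1
  have h2 : IsLocalRing.closedPoint (X.presheaf.stalk x) ∈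
      (X.fromSpecStalk x ≫ φ) ⁻¹ᵁ Proj.basicOpen (binaryGrading K) (MvPolynomial.X j) ↔
      IsUnit (v j) := by
    rw [h1]
    exact not_iff_comm.mp (IsLocalRing.mem_maximalIdeal (v j)).symm
  rw [← h2]
  change _ ↔ φ (X.fromSpecStalk x (IsLocalRing.closedPoint (X.presheaf.stalk x))) ∈
    Proj.basicOpen (binaryGrading K) (MvPolynomial.X j)
  rw [Scheme.fromSpecStalk_closedPoint]

/-- The map Spec 𝒪ₓ → ℙ¹ factors through Spec 𝒪 at φ(x) and through a chart. Both maps to ℙ¹ are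
formally unramified, so either first factor is formally unramified exactly when the composite is. -/
lemma formallyUnramified_stalkMap_iff {X : Scheme.{u}} (φ : X ⟶ ProjSpace 1 K) (x : X)
    (k : K →+* X.presheaf.stalk x) (v : Fin (1 + 1) → X.presheaf.stalk x) {i j : Fin (1 + 1)}
    (hij : i ≠ j) (hi : v i = 1)
    (h : X.fromSpecStalk x ≫ φ = toProjLine k v i (hi ▸ isUnit_one)) :
    (φ.stalkMap x).hom.FormallyUnramified ↔ IsUnramifiedElt k (v j) := by
  rw [← evalAway_formallyUnramified_iff k v hij hi (by simp [hi])]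
  have h1 := Scheme.SpecMap_stalkMap_fromSpecStalk φ (x := x)
  rw [h, toProjLine] at h1
  have h2 {A B : CommRingCat.{u}} (f : A ⟶ B) :
      FormallyUnramified (Spec.map f) ↔ f.hom.FormallyUnramified :=
    HasRingHomProperty.Spec_iff
  rw [← h2]
  have h3 := h2 (CommRingCat.ofHom (evalAway k v (MvPolynomial.X i) (by simp [hi])))
  rw [CommRingCat.hom_ofHom] at h3
  rw [← h3]
  constructor
  · intro _
    have : FormallyUnramified (Spec.map (CommRingCat.ofHom
      (evalAway k v (MvPolynomial.X i) (by simp [hi]))) ≫ chart K i) := by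
      rw [← h1]
      exact MorphismProperty.comp_mem _ _ _ ‹_› inferInstance
    exact .of_comp _ (chart K i)
  · intro _
    have : FormallyUnramified (Spec.map (φ.stalkMap x) ≫ (ProjSpace 1 K).fromSpecStalk _) := by
      rw [h1]
      exact MorphismProperty.comp_mem _ _ _ ‹_› inferInstance
    exact .of_comp _ ((ProjSpace 1 K).fromSpecStalk _)

end Charts

/-! ### Properness of ℙⁿ and the point ∞ -/

section Infinity

variable {K : Type u} [Field K]

lemma adjoin_range_X (K : Type u) [Field K] (n : ℕ) :
    Algebra.adjoin (MvPolynomial.homogeneousSubmodule (Fin n) K 0)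
      (Set.range fun i : Fin n ↦ (MvPolynomial.X i : MvPolynomial (Fin n) K)) = ⊤ := by
  rw [eq_top_iff]
  intro x _
  induction x using MvPolynomial.induction_on with
  | C a =>
    exact Subalgebra.algebraMap_mem _ (⟨MvPolynomial.C a, MvPolynomial.isHomogeneous_C _ _⟩ :
      MvPolynomial.homogeneousSubmodule (Fin n) K 0)
  | add p q hp hq => exact add_mem (hp trivial) (hq trivial)
  | mul_X p i hp => exact mul_mem (hp trivial) (Algebra.subset_adjoin ⟨i, rfl⟩)

lemma exists_mem_basicOpen_X (y : ProjSpace 1 K) :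
    ∃ i, y ∈ Proj.basicOpen (binaryGrading K) (MvPolynomial.X i) := by
  have h := Proj.iSup_basicOpen_eq_top' (binaryGrading K)
    (fun i : Fin (1 + 1) ↦ MvPolynomial.X i) (fun i ↦ ⟨1, X_mem_binaryGrading K i⟩)
    (adjoin_range_X K _)
  exact TopologicalSpace.Opens.mem_iSup.mp (h ▸ TopologicalSpace.Opens.mem_top y)

instance isProper_toSpec (K : Type u) [Field K] (n : ℕ) : IsProper (ProjSpace.toSpec n K) := by
  have : Algebra.FiniteType (MvPolynomial.homogeneousSubmodule (Fin (n + 1)) K 0)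
      (MvPolynomial (Fin (n + 1)) K) := by
    classical
    exact ⟨⟨Finset.univ.image fun i ↦ MvPolynomial.X i, by
      rw [Finset.coe_image, Finset.coe_univ, Set.image_univ, adjoin_range_X]⟩⟩
  -- The degree-zero part consists of the constants, so K surjects onto it.
  have : IsClosedImmersion (Spec.map (CommRingCat.ofHom
      (algebraMap K (MvPolynomial.homogeneousSubmodule (Fin (n + 1)) K 0)))) := by
    apply IsClosedImmersion.spec_of_surjective
    rintro ⟨q, hq⟩
    refine ⟨MvPolynomial.coeff 0 q, Subtype.ext ?_⟩
    have : q.totalDegree = 0 := by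
      simpa using (MvPolynomial.IsHomogeneous.totalDegree_le hq)
    exact (MvPolynomial.totalDegree_eq_zero_iff_eq_C.mp this).symm
  rw [ProjSpace.toSpec]
  infer_instance

/-- Such a point is [1 : v] with v a nonunit of the field K̄, hence v = 0. -/
lemma GeomPoint.eq_of_notMem {P Q : GeomPoint (ProjSpace.toSpec 1 K)}
    (hP : P.pt ∉ Proj.basicOpen (binaryGrading K) (MvPolynomial.X 1))
    (hQ : Q.pt ∉ Proj.basicOpen (binaryGrading K) (MvPolynomial.X 1)) : P = Q := by
  have key {P : GeomPoint (ProjSpace.toSpec 1 K)}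
      (hP : P.pt ∉ Proj.basicOpen (binaryGrading K) (MvPolynomial.X 1)) :
      P.hom = toProjLine (algebraMap K (AlgebraicClosure K)) ![1, 0] 0 (by simp) := by
    have h0 : P.pt ∈ Proj.basicOpen (binaryGrading K) (MvPolynomial.X 0) := by
      obtain ⟨i, hi⟩ := exists_mem_basicOpen_X P.pt
      match i with
      | 0 => exact hi
      | 1 => exact absurd hi hP
    obtain ⟨v, hv, h⟩ := exists_eq_toProjLine (algebraMap K (AlgebraicClosure K)) 0 P.hom P.w (by
      rintro _ ⟨z, rfl⟩
      rwa [Subsingleton.elim z (IsLocalRing.closedPoint (AlgebraicClosure K))])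
    have h1 : v 1 = 0 := by
      by_contra h1
      apply hP
      change IsLocalRing.closedPoint (AlgebraicClosure K) ∈
        P.hom ⁻¹ᵁ Proj.basicOpen (binaryGrading K) (MvPolynomial.X 1)
      rw [h, toProjLine_preimage_basicOpen]
      exact fun h2 ↦ h1 (by simpa using (IsLocalRing.mem_maximalIdeal _).mp h2)
    have h2 : v = ![1, 0] := by
      ext i
      match i with
      | 0 => exact hv
      | 1 => exact h1
    subst h2
    exact h
  ext1
  rw [key hP, key hQ]

lemma infty_notMem_basicOpen :
    (infty K).pt ∉ Proj.basicOpen (binaryGrading K) (MvPolynomial.X 1) := by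
  intro h
  change specClosure K (IsLocalRing.closedPoint (AlgebraicClosure K)) ∈
    inftyHom K ⁻¹ᵁ Proj.basicOpen (binaryGrading K) (MvPolynomial.X 1) at h
  rw [inftyHom,
    Proj.fromOfGlobalSections_preimage_basicOpen _ _ _ one_pos (X_mem_binaryGrading K 1)] at h
  simp [evalInfty] at h

lemma GeomPoint.eq_infty_iff {P : GeomPoint (ProjSpace.toSpec 1 K)} :
    P = infty K ↔ P.pt ∉ Proj.basicOpen (binaryGrading K) (MvPolynomial.X 1) :=
  ⟨fun h ↦ h ▸ infty_notMem_basicOpen, fun h ↦ GeomPoint.eq_of_notMem h infty_notMem_basicOpen⟩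

end Infinity

end BelyiCharP

end

noncomputable section

namespace BelyiCharP

attribute [local instance] MvPolynomial.gradedAlgebra

/-! ### Local rings of a curve -/

section LocalRings

variable {K : Type u} [Field K] {C : Scheme.{u}} (f : C ⟶ Spec (CommRingCat.of K))

/-- The structure morphism of the local ring of a `K`-scheme at a point. -/
def toStalk (x : C) : K →+* C.presheaf.stalk x :=
  (Spec.preimage (C.fromSpecStalk x ≫ f)).hom

lemma specMap_toStalk (x : C) :
    Spec.map (CommRingCat.ofHom (toStalk f x)) = C.fromSpecStalk x ≫ f := by
  rw [toStalk, CommRingCat.ofHom_hom, Spec.map_preimage]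

lemma stalkSpecializes_comp_toStalk {x y : C} (h : x ⤳ y) :
    (C.presheaf.stalkSpecializes h).hom.comp (toStalk f y) = toStalk f x := by
  have : CommRingCat.ofHom (toStalk f y) ≫ C.presheaf.stalkSpecializes h =
      CommRingCat.ofHom (toStalk f x) := by
    apply Spec.map_injective
    rw [Spec.map_comp, specMap_toStalk, specMap_toStalk,
      Scheme.SpecMap_stalkSpecializes_fromSpecStalk_assoc]
  exact congrArg CommRingCat.Hom.hom this

/-- The structure morphism of the ring of sections of a `K`-scheme over an open subset. -/
def toSections (V : C.Opens) : K →+* Γ(C, V) :=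
  (f.appLE ⊤ V le_top).hom.comp (Scheme.ΓSpecIso (CommRingCat.of K)).inv.hom

lemma germ_comp_toSections {V : C.Opens} (hV : IsAffineOpen V) {x : C} (hx : x ∈ V) :
    (C.presheaf.germ V x hx).hom.comp (toSections f V) = toStalk f x := by
  have : CommRingCat.ofHom (toSections f V) ≫ C.presheaf.germ V x hx =
      CommRingCat.ofHom (toStalk f x) := by
    apply Spec.map_injective
    rw [specMap_toStalk, ← hV.fromSpecStalk_eq_fromSpecStalk hx, IsAffineOpen.fromSpecStalk,
      Category.assoc, ← (isAffineOpen_top _).SpecMap_appLE_fromSpec f hV le_top]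
    simp [toSections, IsAffineOpen.fromSpec_top, Scheme.isoSpec_Spec_inv]
  exact congrArg CommRingCat.Hom.hom this

lemma isSmoothCurveLocalRing_toStalk [SmoothOfRelativeDimension 1 f] (x : C) :
    IsSmoothCurveLocalRing (toStalk f x) := by
  obtain ⟨U, hU, V, hV, hx, e, h⟩ :=
    SmoothOfRelativeDimension.exists_isStandardSmoothOfRelativeDimension (n := 1) (f := f) x
  -- Spec K has a single point, so the nonempty open U is everything.
  obtain rfl : U = ⊤ := by
    ext y
    simp only [TopologicalSpace.Opens.coe_top, Set.mem_univ, iff_true]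
    have h1 : f x ∈ U := e hx
    rwa [Subsingleton.elim (f x) y] at h1
  have hk : (toSections f V).IsStandardSmoothOfRelativeDimension 1 :=
    (RingHom.isStandardSmoothOfRelativeDimension_respectsIso).2 _
      (Scheme.ΓSpecIso (CommRingCat.of K)).symm.commRingCatIsoToRingEquiv h
  let : Algebra Γ(C, V) (C.presheaf.stalk x) := C.presheaf.algebra_section_stalk ⟨x, hx⟩
  have : IsLocalization.AtPrime (C.presheaf.stalk x) (hV.primeIdealOf ⟨x, hx⟩).asIdeal :=
    hV.isLocalization_stalk ⟨x, hx⟩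
  rw [← germ_comp_toSections f hV hx]
  exact isSmoothCurveLocalRing_of_isStandardSmooth (R := C.presheaf.stalk x) _ hk
    (hV.primeIdealOf ⟨x, hx⟩).asIdeal

end LocalRings

namespace IsCurve

variable {K : Type u} [Field K] {C : Scheme.{u}} {f : C ⟶ Spec (CommRingCat.of K)}

lemma irreducibleSpace (hC : IsCurve f) : IrreducibleSpace C :=
  have := hC.geometricallyIrreducible
  GeometricallyIrreducible.irreducibleSpace_of_subsingleton (f := f)

lemma isIntegral (hC : IsCurve f) : IsIntegral C := by
  have := hC.irreducibleSpace
  have := hC.smooth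
  have : IsReduced C := by
    have (x : C) : _root_.IsReduced (C.presheaf.stalk x) :=
      have := (isSmoothCurveLocalRing_toStalk f x).isDomain
      inferInstance
    exact isReduced_of_isReduced_stalk C
  exact isIntegral_of_irreducibleSpace_of_isReduced C

lemma isProper (hC : IsCurve f) : IsProper f := by
  obtain ⟨n, i, hi, rfl⟩ := hC.projective
  infer_instance

end IsCurve

/-! ### Closed points and closed subsets -/

section Points

variable {K : Type u} [Field K] {C : Scheme.{u}} (f : C ⟶ Spec (CommRingCat.of K))
  [SmoothOfRelativeDimension 1 f] [IsIntegral C]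

include f

/-- Generalizations of y correspond to primes of its local ring, which are only ⊥ and the maximal
ideal: the generic point and y itself. -/
lemma eq_of_specializes {x y : C} (hx : x ≠ genericPoint C) (h : x ⤳ y) : x = y := by
  have h1 (z : C) (hz : z ⤳ y) (hzy : z ≠ y) : ∃ q, C.fromSpecStalk y q = z ∧ q.asIdeal = ⊥ := by
    obtain ⟨q, hq⟩ : z ∈ Set.range (C.fromSpecStalk y) := by
      rwa [Scheme.range_fromSpecStalk]
    have : q.asIdeal.IsPrime := q.2
    refine ⟨q, hq, ?_⟩
    refine ((isSmoothCurveLocalRing_toStalk f y).eq_bot_or_eq_maximalIdeal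
      q.asIdeal).resolve_right fun h2 ↦ hzy ?_
    have : q = IsLocalRing.closedPoint _ := PrimeSpectrum.ext h2
    exact hq.symm.trans ((congrArg _ this).trans Scheme.fromSpecStalk_closedPoint)
  by_contra hxy
  obtain ⟨q, hq, hq0⟩ := h1 x h hxy
  have hy : genericPoint C ≠ y := by
    rintro rfl
    exact hx ((genericPoint_specializes x).antisymm h).eq.symm
  obtain ⟨r, hr, hr0⟩ := h1 _ (genericPoint_specializes y) hy
  apply hx
  rw [← hq, ← hr, PrimeSpectrum.ext (hq0.trans hr0.symm)]

lemma isClosed_singleton {x : C} (hx : x ≠ genericPoint C) : IsClosed {x} := by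
  rw [← closure_subset_iff_isClosed]
  intro y hy
  exact (eq_of_specializes f hx (specializes_iff_mem_closure.mpr hy)).symm

/-- A closed subset of a Noetherian space has finitely many irreducible components; here the generic
point of each is a closed point of the curve. -/
lemma finite_of_isClosed [QuasiCompact f] {Z : Set C} (hZ : IsClosed Z) (hη : genericPoint C ∉ Z) :
    Z.Finite := by
  have := SmoothOfRelativeDimension.smooth 1 f
  have : IsLocallyNoetherian C := LocallyOfFiniteType.isLocallyNoetherian f
  have : CompactSpace C := (quasiCompact_iff_compactSpace f).mp inferInstance
  have : IsNoetherian C := {}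
  obtain ⟨S, hS, hSc, hSi, rfl⟩ :=
    TopologicalSpace.NoetherianSpace.exists_finite_set_isClosed_irreducible hZ
  refine hS.sUnion fun W hW ↦ ?_
  obtain ⟨w, hw⟩ := QuasiSober.sober (hSi W hW) (hSc W hW)
  have hwW : w ∈ W := hw.mem
  have : IsClosed {w} := isClosed_singleton f fun h ↦ hη (h ▸ Set.mem_sUnion_of_mem hwW hW)
  rw [← hw.def, this.closure_eq]
  exact Set.finite_singleton w

end Points

/-! ### Geometric points and residue fields -/

section GeomPoints

variable {K : Type u} [Field K] {C : Scheme.{u}} {f : C ⟶ Spec (CommRingCat.of K)}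

/-- The structure morphism of the residue field of a `K`-scheme at a point. -/
def toResidueField (f : C ⟶ Spec (CommRingCat.of K)) (x : C) : K →+* C.residueField x :=
  (C.residue x).hom.comp (toStalk f x)

lemma specMap_toResidueField (x : C) :
    Spec.map (CommRingCat.ofHom (toResidueField f x)) = C.fromSpecResidueField x ≫ f := by
  rw [toResidueField, CommRingCat.ofHom_comp, Spec.map_comp, specMap_toStalk, CommRingCat.ofHom_hom,
    Scheme.fromSpecResidueField, Category.assoc]

lemma GeomPoint.exists_residueField (P : GeomPoint f) {x : C} (hx : P.pt = x) :
    ∃ g : C.residueField x →+* AlgebraicClosure K,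
      P.hom = Spec.map (CommRingCat.ofHom g) ≫ C.fromSpecResidueField x ∧
      g.comp (toResidueField f x) = algebraMap K (AlgebraicClosure K) := by
  subst hx
  obtain ⟨g, hg⟩ : ∃ g : C.residueField P.pt ⟶ CommRingCat.of (AlgebraicClosure K),
      Spec.map g ≫ C.fromSpecResidueField P.pt = P.hom :=
    ⟨_, Scheme.descResidueField_stalkClosedPointTo_fromSpecResidueField _ C P.hom⟩
  refine ⟨g.hom, hg.symm, ?_⟩
  have : CommRingCat.ofHom (toResidueField f P.pt) ≫ g =
      CommRingCat.ofHom (algebraMap K (AlgebraicClosure K)) := by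
    apply Spec.map_injective
    rw [Spec.map_comp, specMap_toResidueField, reassoc_of% hg]
    exact P.w
  exact congrArg CommRingCat.Hom.hom this

/-- The residue field embeds into K̄ over K, so it is algebraic. -/
lemma GeomPoint.exists_eval₂_mem_maximalIdeal (P : GeomPoint f) (a : C.presheaf.stalk P.pt) :
    ∃ q : Polynomial K, q ≠ 0 ∧
      q.eval₂ (toStalk f P.pt) a ∈ IsLocalRing.maximalIdeal (C.presheaf.stalk P.pt) := by
  obtain ⟨g, -, hg⟩ := P.exists_residueField rfl
  obtain ⟨q, hq, hqa⟩ := Algebra.IsAlgebraic.isAlgebraic (R := K) (g ((C.residue P.pt).hom a))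
  refine ⟨q, hq, ?_⟩
  rw [Polynomial.aeval_def, ← hg, toResidueField, ← Polynomial.hom_eval₂, ← Polynomial.hom_eval₂,
    map_eq_zero_iff g g.injective] at hqa
  exact (IsLocalRing.residue_eq_zero_iff _).mp hqa

lemma GeomPoint.pt_ne_genericPoint [PerfectField K] [SmoothOfRelativeDimension 1 f] [IsIntegral C]
    (P : GeomPoint f) : P.pt ≠ genericPoint C := by
  intro h
  have h1 := (isSmoothCurveLocalRing_toStalk f P.pt).maximalIdeal_ne_bot
    P.exists_eval₂_mem_maximalIdeal
  rw [h] at h1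
  exact h1 (IsLocalRing.maximalIdeal_eq_bot (R := C.functionField))

/-- Two K-embeddings of the residue field into K̄ differ by an automorphism: one extends along the
other, as K̄ is algebraically closed and algebraic over the residue field. -/
lemma GeomPoint.exists_eq_conj {s t : GeomPoint f} (h : s.pt = t.pt) :
    ∃ σ : AlgebraicClosure K ≃ₐ[K] AlgebraicClosure K, s = t.conj σ := by
  obtain ⟨g, hg, hgk⟩ := s.exists_residueField h
  obtain ⟨g', hg', hgk'⟩ := t.exists_residueField rfl
  let : Algebra K (C.residueField t.pt) := (toResidueField f t.pt).toAlgebra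
  let : Algebra (C.residueField t.pt) (AlgebraicClosure K) := g'.toAlgebra
  have : IsScalarTower K (C.residueField t.pt) (AlgebraicClosure K) := .of_algebraMap_eq' hgk'.symm
  have : Algebra.IsAlgebraic (C.residueField t.pt) (AlgebraicClosure K) :=
    Algebra.IsAlgebraic.tower_top (K := K) _
  let gA : C.residueField t.pt →ₐ[K] AlgebraicClosure K :=
    { g with commutes' := RingHom.congr_fun hgk }
  obtain ⟨φ, hφ⟩ := IsAlgClosed.surjective_domRestrict_of_isAlgebraic
    (E := AlgebraicClosure K) gA
  refine ⟨AlgEquiv.ofBijective φ (Algebra.IsAlgebraic.algHom_bijective φ), ?_⟩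
  ext1
  change s.hom = Spec.map (CommRingCat.ofHom φ.toRingHom) ≫ t.hom
  rw [hg, hg', ← Category.assoc, ← Spec.map_comp, ← CommRingCat.ofHom_comp]
  congr 3
  ext a
  exact (DFunLike.congr_fun hφ a).symm

/-- By the Nullstellensatz the residue field of a closed point is finite over K, so it embeds into
K̄. -/
lemma exists_geomPoint_of_isClosed [LocallyOfFiniteType f] {x : C} (hx : IsClosed {x}) :
    ∃ P : GeomPoint f, P.pt = x := by
  have : IsFinite (C.fromSpecResidueField x ≫ f) := by
    rw [isClosed_singleton_iff_isClosedImmersion] at hx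
    rw [isFinite_iff_locallyOfFiniteType_of_jacobsonSpace]
    infer_instance
  let : Algebra K (C.residueField x) := (toResidueField f x).toAlgebra
  have : Algebra.IsAlgebraic K (C.residueField x) := by
    have h : (toResidueField f x).IsIntegral := by
      rw [← CommRingCat.hom_ofHom (toResidueField f x), ← IsIntegralHom.SpecMap_iff]
      rw [specMap_toResidueField]
      infer_instance
    have : Algebra.IsIntegral K (C.residueField x) := ⟨h⟩
    infer_instance
  let g : C.residueField x →ₐ[K] AlgebraicClosure K := IsAlgClosed.lift
  refine ⟨⟨Spec.map (CommRingCat.ofHom g.toRingHom) ≫ C.fromSpecResidueField x, ?_⟩, ?_⟩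
  · rw [Category.assoc, ← specMap_toResidueField, ← Spec.map_comp, ← CommRingCat.ofHom_comp,
      specClosure]
    congr 2
    exact g.comp_algebraMap
  · change C.fromSpecResidueField x (Spec.map (CommRingCat.ofHom g.toRingHom) _) = x
    exact C.fromSpecResidueField_apply x _

lemma exists_geomPoint_mem [LocallyOfFiniteType f] (U : C.Opens) (hU : (U : Set C).Nonempty) :
    ∃ P : GeomPoint f, P.pt ∈ U := by
  have : JacobsonSpace C := LocallyOfFiniteType.jacobsonSpace f
  obtain ⟨x, hxU, hx⟩ : ((U : Set C) ∩ closedPoints C).Nonempty := by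
    have h := JacobsonSpace.closure_inter_closedPoints_eq_closure U.2.isLocallyClosed
    exact closure_nonempty_iff.mp (h ▸ hU.closure)
  obtain ⟨P, rfl⟩ := exists_geomPoint_of_isClosed (f := f) hx
  exact ⟨P, hxU⟩

end GeomPoints

end BelyiCharP

end

noncomputable section

namespace BelyiCharP

attribute [local instance] MvPolynomial.gradedAlgebra

/-! ### Finite sets of closed points lie in affine opens -/

section PrimeAvoidance

variable {A σ : Type*} [CommRing A] [SetLike σ A] [AddSubgroupClass σ A] (𝒜 : ℕ → σ)
  [GradedRing 𝒜]

lemma exists_homogeneous_mem_notMem {I J : HomogeneousIdeal 𝒜} (h : ¬ I ≤ J) :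
    ∃ n, ∃ a ∈ 𝒜 n, a ∈ I ∧ a ∉ J := by
  classical
  obtain ⟨a, haI, haJ⟩ := SetLike.not_le_iff_exists.mp h
  by_contra! H
  apply haJ
  rw [← DirectSum.sum_support_decompose 𝒜 a]
  exact sum_mem fun n _ ↦ H n _ (SetLike.coe_mem _) (I.isHomogeneous n haI)

lemma exists_pos_homogeneous_notMem (x : ProjectiveSpectrum 𝒜) :
    ∃ n, 0 < n ∧ ∃ a ∈ 𝒜 n, a ∉ x.asHomogeneousIdeal := by
  obtain ⟨n, a, ha, ha', hax⟩ := exists_homogeneous_mem_notMem 𝒜 x.not_irrelevant_le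
  refine ⟨n, Nat.pos_of_ne_zero ?_, a, ha, hax⟩
  rintro rfl
  apply hax
  rw [HomogeneousIdeal.mem_irrelevant_iff, GradedRing.proj_apply,
    DirectSum.decompose_of_mem_same _ ha] at ha'
  rw [ha']
  exact zero_mem _

/-- Homogeneous prime avoidance for pairwise incomparable primes. -/
lemma exists_homogeneous_forall_notMem (s : Finset (ProjectiveSpectrum 𝒜))
    (hs : ∀ x ∈ s, ∀ y ∈ s, x ≠ y → ¬ x.asHomogeneousIdeal ≤ y.asHomogeneousIdeal) :
    ∃ n, 0 < n ∧ ∃ a ∈ 𝒜 n, ∀ x ∈ s, a ∉ x.asHomogeneousIdeal := by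
  classical
  induction s using Finset.induction_on with
  | empty => exact ⟨1, one_pos, 0, zero_mem _, by simp⟩
  | insert y s hy ih =>
    obtain ⟨n, hn, a, ha, has⟩ := ih fun x hx z hz ↦
      hs x (Finset.mem_insert_of_mem hx) z (Finset.mem_insert_of_mem hz)
    by_cases hay : a ∈ y.asHomogeneousIdeal
    swap
    · refine ⟨n, hn, a, ha, fun x hx ↦ ?_⟩
      rcases Finset.mem_insert.mp hx with rfl | hx
      exacts [hay, has x hx]
    -- A product of elements separating each x ∈ s from y; the extra factor `e` keeps the degree
    -- positive even when s is empty.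
    obtain ⟨m, hm, b, hb, hby, hbs⟩ : ∃ m, 0 < m ∧ ∃ b ∈ 𝒜 m, b ∉ y.asHomogeneousIdeal ∧
        ∀ x ∈ s, b ∈ x.asHomogeneousIdeal := by
      choose! d c hc hcx hcy using fun x (hx : x ∈ s) ↦ exists_homogeneous_mem_notMem 𝒜
        (hs x (Finset.mem_insert_of_mem hx) y (Finset.mem_insert_self y s)
          (ne_of_mem_of_not_mem hx hy))
      obtain ⟨k, hk, e, he, hey⟩ := exists_pos_homogeneous_notMem 𝒜 y
      refine ⟨k + ∑ x ∈ s, d x, by lia, e * ∏ x ∈ s, c x,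
        SetLike.mul_mem_graded he (SetLike.prod_mem_graded _ _ _ hc), fun h ↦ ?_, fun x hx ↦ ?_⟩
      · rcases y.isPrime.mem_or_mem h with h | h
        · exact hey h
        · obtain ⟨x, hx, h⟩ := (y.isPrime.prod_mem_iff).mp h
          exact hcy x hx h
      · exact Ideal.mul_mem_left _ _ (Ideal.mem_of_dvd _ (Finset.dvd_prod_of_mem c hx) (hcx x hx))
    -- The powers equalize degrees. At each prime exactly one of the two summands lies in the prime,
    -- so the sum does not.
    refine ⟨m * n, Nat.mul_pos hm hn, a ^ m + b ^ n, add_mem (SetLike.pow_mem_graded m ha) ?_,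
      fun x hx h ↦ ?_⟩
    · rw [mul_comm]
      exact SetLike.pow_mem_graded n hb
    · rcases Finset.mem_insert.mp hx with rfl | hx
      · exact hby (x.isPrime.mem_of_pow_mem n
          ((Ideal.add_mem_iff_right _ (Ideal.pow_mem_of_mem _ hay m hm)).mp h))
      · exact has x hx (x.isPrime.mem_of_pow_mem m
          ((Ideal.add_mem_iff_left _ (Ideal.pow_mem_of_mem _ (hbs x hx) n hn)).mp h))

end PrimeAvoidance

/-- Distinct closed points of projective space are incomparable primes, so some form avoids all of
them; its nonvanishing locus is affine and pulls back to an affine open under the closed immersion.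
-/
lemma IsCurve.exists_isAffineOpen {K : Type u} [Field K] {C : Scheme.{u}}
    {f : C ⟶ Spec (CommRingCat.of K)} (hC : IsCurve f) {s : Set C} (hs : s.Finite)
    (hcl : ∀ x ∈ s, IsClosed {x}) : ∃ U : C.Opens, IsAffineOpen U ∧ s ⊆ U := by
  classical
  obtain ⟨n, i, hi, -⟩ := hC.projective
  obtain ⟨m, hm, a, ha, has⟩ := exists_homogeneous_forall_notMem
    (MvPolynomial.homogeneousSubmodule (Fin (n + 1)) K) (hs.toFinset.image i) (by
      intro x' hx' y' hy' hxy h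
      obtain ⟨x, hx, rfl⟩ := Finset.mem_image.mp hx'
      obtain ⟨y, hy, rfl⟩ := Finset.mem_image.mp hy'
      rw [Set.Finite.mem_toFinset] at hx
      have h1 : (i x : ProjSpace n K) ⤳ i y := by
        rw [specializes_iff_mem_closure]
        exact (ProjectiveSpectrum.le_iff_mem_closure _ _ _).mp h
      have h2 : IsClosed {i x} := by
        rw [← Set.image_singleton]
        exact i.isClosedEmbedding.isClosedMap _ (hcl x hx)
      have h3 := h2.closure_eq ▸ specializes_iff_mem_closure.mp h1
      exact hxy h3.symm)
  refine ⟨i ⁻¹ᵁ Proj.basicOpen _ a, (Proj.isAffineOpen_basicOpen _ a ha hm).preimage i,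
    fun x hx ↦ has (i x) (Finset.mem_image_of_mem i (hs.mem_toFinset.mpr hx))⟩

end BelyiCharP

end

noncomputable section

namespace BelyiCharP

/-! ### Approximation and denominators in an affine ring -/

section Approximation

open IsLocalRing

/-- As q is maximal, a denominator outside q is already invertible modulo q². -/
lemma exists_sub_algebraMap_mem_sq {A R : Type*} [CommRing A] [CommRing R] [IsLocalRing R]
    [Algebra A R] (q : Ideal A) [hq : q.IsMaximal] [IsLocalization.AtPrime R q] (a : R) :
    ∃ b : A, a - algebraMap A R b ∈ maximalIdeal R ^ 2 := by
  obtain ⟨n, s, rfl⟩ := IsLocalization.exists_mk'_eq q.primeCompl a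
  have hs : (s : A) ∉ q := s.2
  have h1 : IsCoprime (Ideal.span {(s : A)}) (q ^ 2) := by
    refine IsCoprime.pow_right (Ideal.isCoprime_iff_sup_eq.mpr ?_)
    refine hq.1.2 _ (lt_of_le_of_ne le_sup_right fun h ↦ hs ?_)
    exact h.ge <| Ideal.mem_sup_left (Ideal.mem_span_singleton_self _)
  obtain ⟨y, hy, z, hz, hyz⟩ := Ideal.isCoprime_iff_exists.mp h1
  obtain ⟨s', rfl⟩ := Ideal.mem_span_singleton'.mp hy
  refine ⟨n * s', ?_⟩
  have h2 : algebraMap A R z ∈ maximalIdeal R ^ 2 := by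
    rw [← IsLocalization.AtPrime.map_eq_maximalIdeal q R, ← Ideal.map_pow]
    exact Ideal.mem_map_of_mem _ hz
  have h3 : IsLocalization.mk' R n s - algebraMap A R (n * s') =
      IsLocalization.mk' R n s * algebraMap A R z := by
    have h4 : algebraMap A R n = IsLocalization.mk' R n s * algebraMap A R s :=
      (IsLocalization.mk'_spec R n s).symm
    rw [← eq_sub_iff_add_eq'] at hyz
    rw [hyz, map_mul, h4, map_sub, map_mul, map_one]
    ring
  rw [h3]
  exact Ideal.mul_mem_left _ _ h2

lemma exists_forall_sub_mem_sq {A ι : Type*} [CommRing A] [Finite ι] (P : ι → Ideal A)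
    (hP : ∀ i, (P i).IsMaximal) (hinj : Function.Injective P) (b : ι → A) :
    ∃ a, ∀ i, b i - a ∈ P i ^ 2 := by
  obtain ⟨a, ha⟩ := Ideal.exists_forall_sub_mem_ideal (I := fun i ↦ P i ^ 2)
    (fun i j hij ↦ IsCoprime.pow <| Ideal.isCoprime_iff_sup_eq.mpr <|
      (hP i).coprime_of_ne (hP j) fun h ↦ hij (hinj h)) b
  refine ⟨a, fun i ↦ ?_⟩
  rw [← neg_sub, neg_mem_iff]
  exact ha i

/-- Let I be the ideal of denominators of g. No Q j contains I or any P i, so prime avoidance gives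
an element of I·∏ P i outside every Q j. -/
lemma exists_denominator {A F ι κ : Type*} [CommRing A] [Field F] [Algebra A F] [Finite ι]
    [Finite κ] [Nonempty κ] (g : F) (P : ι → Ideal A) (Q : κ → Ideal A)
    (hQ : ∀ j, (Q j).IsPrime) (hPQ : ∀ i j, ¬ P i ≤ Q j)
    (hg : ∀ j, ∃ s ∉ Q j, ∃ a, g * algebraMap A F s = algebraMap A F a) :
    ∃ h, (∀ i, h ∈ P i) ∧ (∀ j, h ∉ Q j) ∧ ∃ c, g * algebraMap A F h = algebraMap A F c := by
  have := Fintype.ofFinite ι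
  have := Fintype.ofFinite κ
  obtain ⟨I, hI⟩ : ∃ I : Ideal A, ∀ s, s ∈ I ↔
      ∃ a, g * algebraMap A F s = algebraMap A F a :=
    ⟨(LinearMap.range (Algebra.linearMap A F)).comap (LinearMap.toSpanSingleton A F g), fun s ↦ by
      simp [Algebra.smul_def, mul_comm, eq_comm]⟩
  have hJ : ¬ (((I * ∏ i, P i : Ideal A) : Set A) ⊆
      ⋃ j ∈ ((Finset.univ : Finset κ) : Set κ), Q j) := by
    rw [Ideal.subset_union_prime (Classical.arbitrary κ) (Classical.arbitrary κ) fun j _ _ _ ↦ hQ j]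
    rintro ⟨j, -, hle⟩
    rcases (hQ j).mul_le.mp hle with h | h
    · obtain ⟨s, hs, hs'⟩ := hg j
      exact hs (h ((hI s).mpr hs'))
    · obtain ⟨i, -, h⟩ := (hQ j).prod_le.mp h
      exact hPQ i j h
  obtain ⟨h, hhJ, hh⟩ := Set.not_subset.mp hJ
  simp only [Finset.coe_univ, Set.mem_univ, Set.iUnion_true, Set.mem_iUnion, not_exists] at hh
  have hhJ' : h ∈ I * ∏ i, P i := hhJ
  have h1 : h ∈ ∏ i, P i := (Ideal.mul_le_right : I * ∏ i, P i ≤ _) hhJ'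
  have h3 : h ∈ I := (Ideal.mul_le_left : I * ∏ i, P i ≤ _) hhJ'
  have h2 (i : ι) : ∏ i, P i ≤ P i := Ideal.prod_le_inf.trans (Finset.inf_le (Finset.mem_univ i))
  exact ⟨h, fun i ↦ h2 i h1, hh, (hI h).mp h3⟩

open Polynomial in
-- The open set is the unramified locus of A over K[X]. Allowing any localization R lets the
-- statement apply directly to stalks.
lemma exists_opens_mem_iff_isUnramifiedElt {K A : Type u} [CommRing K] [CommRing A]
    (k : K →+* A) (hk : k.FiniteType) (g : A) :
    ∃ V : TopologicalSpace.Opens (PrimeSpectrum A), ∀ (q : PrimeSpectrum A) (R : Type u)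
      [CommRing R] [Algebra A R] [IsLocalization.AtPrime R q.asIdeal],
      q ∈ V ↔ IsUnramifiedElt ((algebraMap A R).comp k) (algebraMap A R g) := by
  let : Algebra K[X] A := (eval₂RingHom k g).toAlgebra
  have : Algebra.FiniteType K[X] A := by
    have h : ((eval₂RingHom k g).comp C).FiniteType := by
      convert hk using 1
      ext
      simp
    exact RingHom.FiniteType.of_comp_finiteType h
  refine ⟨⟨Algebra.unramifiedLocus K[X] A, Algebra.isOpen_unramifiedLocus⟩, fun q R _ _ _ ↦ ?_⟩
  let : Algebra K[X] R := ((algebraMap A R).comp (eval₂RingHom k g)).toAlgebra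
  have : IsScalarTower K[X] A R := .of_algebraMap_eq' rfl
  have h : eval₂RingHom ((algebraMap A R).comp k) (algebraMap A R g) = algebraMap K[X] R := by
    rw [RingHom.algebraMap_toAlgebra]
    ext <;> simp
  rw [IsUnramifiedElt, h, RingHom.formallyUnramified_algebraMap]
  exact Algebra.FormallyUnramified.iff_of_equiv
    ((IsLocalization.algEquiv q.asIdeal.primeCompl (Localization.AtPrime q.asIdeal) R).restrictScalars
      K[X])

end Approximation

/-! ### Construction of the rational function -/

section Sections

open IsLocalRing

variable {K : Type u} [Field K] {C : Scheme.{u}} {f : C ⟶ Spec (CommRingCat.of K)}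

lemma germ_mem_maximalIdeal_iff {U : C.Opens} (hU : IsAffineOpen U) (x : U) (a : Γ(C, U)) :
    C.presheaf.germ U x x.2 a ∈ maximalIdeal (C.presheaf.stalk x.1) ↔
      a ∈ (hU.primeIdealOf x).asIdeal := by
  have := hU.isLocalization_stalk x
  exact IsLocalization.AtPrime.to_map_mem_maximal_iff (C.presheaf.stalk x.1)
    (hU.primeIdealOf x).asIdeal a

lemma isMaximal_primeIdealOf {U : C.Opens} (hU : IsAffineOpen U) (x : U)
    (hx : IsClosed {x.1}) : (hU.primeIdealOf x).asIdeal.IsMaximal := by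
  rw [← PrimeSpectrum.isClosed_singleton_iff_isMaximal]
  have : hU.fromSpec ⁻¹' {x.1} = {hU.primeIdealOf x} := by
    ext y
    simp only [Set.mem_preimage, Set.mem_singleton_iff]
    constructor
    · intro h
      exact hU.fromSpec.isOpenEmbedding.injective (h.trans (hU.fromSpec_primeIdealOf x).symm)
    · rintro rfl
      exact hU.fromSpec_primeIdealOf x
  exact (congrArg IsClosed this).mp (hx.preimage hU.fromSpec.continuous)

lemma primeIdealOf_injective {U : C.Opens} (hU : IsAffineOpen U) :
    Function.Injective fun x ↦ (hU.primeIdealOf x).asIdeal := by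
  intro x y h
  apply Subtype.ext
  rw [← hU.fromSpec_primeIdealOf x, ← hU.fromSpec_primeIdealOf y, PrimeSpectrum.ext h]

/-- A rational function on a curve which is regular and unramified at `x`. -/
def IsRegularUnramifiedAt [IsIntegral C] (f : C ⟶ Spec (CommRingCat.of K)) (x : C)
    (φ : C.functionField) : Prop :=
  ∃ b : C.presheaf.stalk x, IsUnramifiedElt (toStalk f x) b ∧ algebraMap _ C.functionField b = φ

/-- A rational function with a pole of order at least two at `x`. -/
def HasMultiplePoleAt [IsIntegral C] (x : C) (φ : C.functionField) : Prop :=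
  ∃ w ∈ maximalIdeal (C.presheaf.stalk x) ^ 2, algebraMap _ C.functionField w * φ = 1

lemma finiteType_toSections [LocallyOfFiniteType f] {U : C.Opens} (hU : IsAffineOpen U) :
    (toSections f U).FiniteType := by
  have h := LocallyOfFiniteType.finiteType_appLE (f := f) (isAffineOpen_top _) hU le_top
  exact h.comp (.of_surjective _
    (Scheme.ΓSpecIso (CommRingCat.of K)).symm.commRingCatIsoToRingEquiv.surjective)

lemma isOpen_setOf_isUnramifiedElt_germ [LocallyOfFiniteType f] {U : C.Opens}
    (hU : IsAffineOpen U) (g : Γ(C, U)) :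
    IsOpen {x | ∃ hx : x ∈ U, IsUnramifiedElt (toStalk f x) (C.presheaf.germ U x hx g)} := by
  obtain ⟨V, hV⟩ := exists_opens_mem_iff_isUnramifiedElt _ (finiteType_toSections (f := f) hU) g
  convert hU.fromSpec.isOpenEmbedding.isOpenMap _ V.2 using 1
  ext x
  have h (hx : x ∈ U) : hU.primeIdealOf ⟨x, hx⟩ ∈ V ↔
      IsUnramifiedElt (toStalk f x) (C.presheaf.germ U x hx g) := by
    let : Algebra Γ(C, U) (C.presheaf.stalk x) := C.presheaf.algebra_section_stalk ⟨x, hx⟩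
    have : IsLocalization.AtPrime (C.presheaf.stalk x) (hU.primeIdealOf ⟨x, hx⟩).asIdeal :=
      hU.isLocalization_stalk ⟨x, hx⟩
    rw [hV _ (C.presheaf.stalk x), ← germ_comp_toSections f hU hx]
    rfl
  constructor
  · rintro ⟨hx, hxg⟩
    exact ⟨_, (h hx).mpr hxg, hU.fromSpec_primeIdealOf ⟨x, hx⟩⟩
  · rintro ⟨y, hy, rfl⟩
    have hx : hU.fromSpec y ∈ U := by
      rw [← SetLike.mem_coe, ← hU.range_fromSpec]
      exact ⟨y, rfl⟩
    refine ⟨hx, (h hx).mp ?_⟩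
    have : hU.primeIdealOf ⟨_, hx⟩ = y :=
      hU.fromSpec.isOpenEmbedding.injective (hU.fromSpec_primeIdealOf ⟨_, hx⟩)
    rwa [this]

/-- In an affine open containing T, the Chinese remainder theorem interpolates local unramified
elements modulo 𝔪ₜ², which suffices to keep them unramified. The good locus contains a nonempty open
set, hence the generic point, and its complement is finite. -/
lemma exists_isRegularUnramifiedAt [IsIntegral C] (hC : IsCurve f) {T : Set C} (hT : T.Finite)
    (hT0 : T.Nonempty) (hTc : ∀ t ∈ T, IsClosed {t}) :
    ∃ g : C.functionField, (∀ t ∈ T, IsRegularUnramifiedAt f t g) ∧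
      IsRegularUnramifiedAt f (genericPoint C) g ∧ {x | ¬ IsRegularUnramifiedAt f x g}.Finite := by
  have := hC.smooth
  have := SmoothOfRelativeDimension.smooth 1 f
  have := hC.isProper
  obtain ⟨U, hU, hTU⟩ := hC.exists_isAffineOpen hT hTc
  have : Nonempty U := ⟨⟨_, hTU hT0.some_mem⟩⟩
  let ι : T → U := fun t ↦ ⟨t.1, hTU t.2⟩
  have (t : T) : ∃ b : Γ(C, U), IsUnramifiedElt (toStalk f t.1)
      (C.presheaf.germ U t.1 (hTU t.2) b) := by
    obtain ⟨a, ha⟩ := (isSmoothCurveLocalRing_toStalk f t.1).exists_isUnramifiedElt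
    let : Algebra Γ(C, U) (C.presheaf.stalk t.1) := C.presheaf.algebra_section_stalk (ι t)
    have : IsLocalization.AtPrime (C.presheaf.stalk t.1) (hU.primeIdealOf (ι t)).asIdeal :=
      hU.isLocalization_stalk (ι t)
    have := isMaximal_primeIdealOf hU (ι t) (hTc t.1 t.2)
    obtain ⟨b, hb⟩ := exists_sub_algebraMap_mem_sq (hU.primeIdealOf (ι t)).asIdeal a
    exact ⟨b, (isSmoothCurveLocalRing_toStalk f t.1).isUnramifiedElt_of_sub_mem ha hb⟩
  choose b hb using this
  have := hT.to_subtype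
  obtain ⟨g, hg⟩ := exists_forall_sub_mem_sq (fun t ↦ (hU.primeIdealOf (ι t)).asIdeal)
    (fun t ↦ isMaximal_primeIdealOf hU (ι t) (hTc t.1 t.2))
    (fun t t' h ↦ Subtype.ext (congrArg (fun y : U ↦ y.1) (primeIdealOf_injective hU h))) b
  have hgU (x : C) (hx : x ∈ U)
      (h : IsUnramifiedElt (toStalk f x) (C.presheaf.germ U x hx g)) :
      IsRegularUnramifiedAt f x (C.germToFunctionField U g) :=
    ⟨_, h, C.algebraMap_germ_eq_germToFunctionField hx g⟩
  have hgT (t : T) :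
      IsUnramifiedElt (toStalk f t.1) (C.presheaf.germ U t.1 (hTU t.2) g) := by
    refine (isSmoothCurveLocalRing_toStalk f t.1).isUnramifiedElt_of_sub_mem (hb t) ?_
    rw [← map_sub]
    have h1 := Ideal.mem_map_of_mem (C.presheaf.germ U t.1 (hTU t.2)).hom (hg t)
    rw [Ideal.map_pow] at h1
    refine Ideal.pow_right_mono (Ideal.map_le_iff_le_comap.mpr fun a ha ↦ ?_) 2 h1
    exact (germ_mem_maximalIdeal_iff hU (ι t) a).mpr ha
  have hopen := isOpen_setOf_isUnramifiedElt_germ (f := f) hU g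
  have hη := (genericPoint_spec C).mem_open_set_iff hopen |>.mpr
      ⟨_, trivial, hTU hT0.some_mem, hgT ⟨_, hT0.some_mem⟩⟩
  refine ⟨C.germToFunctionField U g, fun t ht ↦ hgU t (hTU ht) (hgT ⟨t, ht⟩),
    hgU _ hη.choose hη.choose_spec, ?_⟩
  refine (finite_of_isClosed f hopen.isClosed_compl ?_).subset fun x hx hx' ↦ hx ?_
  · rwa [Set.notMem_compl_iff]
  · obtain ⟨hxU, hxg⟩ := hx'
    exact hgU x hxU hxg

lemma exists_germ_eq_denominator [IsIntegral C] {U : C.Opens} (hU : IsAffineOpen U)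
    {Z T : Set U} (hZ : Z.Finite) (hT : T.Finite) (hT0 : T.Nonempty)
    (hZc : ∀ z ∈ Z, IsClosed {z.1}) (hZT : Disjoint Z T) {g : C.functionField}
    (hg : ∀ t ∈ T, ∃ b, algebraMap (C.presheaf.stalk t.1) C.functionField b = g) :
    ∃ h c : Γ(C, U), (∀ z ∈ Z, C.presheaf.germ U z.1 z.2 h ∈ maximalIdeal _) ∧
      (∀ t ∈ T, IsUnit (C.presheaf.germ U t.1 t.2 h)) ∧
      ∀ x : U, g * algebraMap _ C.functionField (C.presheaf.germ U x.1 x.2 h) =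
        algebraMap _ C.functionField (C.presheaf.germ U x.1 x.2 c) := by
  have : Nonempty U := ⟨hT0.some⟩
  have halg (x : U) (a : Γ(C, U)) : algebraMap (C.presheaf.stalk x.1) C.functionField
      (C.presheaf.germ U x.1 x.2 a) = algebraMap Γ(C, U) C.functionField a :=
    C.algebraMap_germ_eq_germToFunctionField x.2 a
  have := hZ.to_subtype
  have := hT.to_subtype
  have := hT0.to_subtype
  have hdisj (x : Z) (y : T) :
      ¬ (hU.primeIdealOf x.1).asIdeal ≤ (hU.primeIdealOf y.1).asIdeal := by
    intro hxy
    have h1 := (isMaximal_primeIdealOf hU x.1 (hZc x.1 x.2)).eq_of_le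
      (hU.primeIdealOf y.1).2.ne_top hxy
    have h2 : x.1 = y.1 := primeIdealOf_injective hU h1
    exact Set.disjoint_left.mp hZT x.2 (h2 ▸ y.2)
  have hden (y : T) : ∃ s ∉ (hU.primeIdealOf y.1).asIdeal, ∃ a,
      g * algebraMap Γ(C, U) C.functionField s = algebraMap Γ(C, U) C.functionField a := by
    obtain ⟨b, hb⟩ := hg y.1 y.2
    let : Algebra Γ(C, U) (C.presheaf.stalk y.1.1) := C.presheaf.algebra_section_stalk y.1
    have : IsLocalization.AtPrime (C.presheaf.stalk y.1.1) (hU.primeIdealOf y.1).asIdeal :=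
      hU.isLocalization_stalk y.1
    obtain ⟨⟨a, s⟩, has⟩ := IsLocalization.surj (hU.primeIdealOf y.1).asIdeal.primeCompl b
    refine ⟨s, s.2, a, ?_⟩
    rw [← halg y.1, ← halg y.1, ← hb, ← map_mul]
    exact congrArg _ has
  obtain ⟨h, hhZ, hhT, c, hc⟩ := exists_denominator g
    (fun x : Z ↦ (hU.primeIdealOf x.1).asIdeal) (fun x : T ↦ (hU.primeIdealOf x.1).asIdeal)
    (fun x ↦ (hU.primeIdealOf x.1).2) hdisj hden
  refine ⟨h, c, fun z hz ↦ (germ_mem_maximalIdeal_iff hU z h).mpr (hhZ ⟨z, hz⟩), fun t ht ↦ ?_,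
    fun x ↦ by rw [halg, halg, hc]⟩
  by_contra hu
  exact hhT ⟨t, ht⟩ ((germ_mem_maximalIdeal_iff hU t h).mp ((mem_maximalIdeal _).mpr hu))

/-- At Z, regularity of gh ensures that the pole of h⁻ᵖ dominates that of g; at T, the unit
condition keeps h⁻ᵖ regular. -/
lemma IsCurve.exists_denominator [IsIntegral C] (hC : IsCurve f)
    {Z T : Set C} (hZ : Z.Finite) (hT : T.Finite) (hT0 : T.Nonempty)
    (hZc : ∀ z ∈ Z, IsClosed {z}) (hTc : ∀ t ∈ T, IsClosed {t}) (hZT : Disjoint Z T)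
    {g : C.functionField}
    (hg : ∀ t ∈ T, ∃ b, algebraMap (C.presheaf.stalk t) C.functionField b = g) :
    ∃ h : C.functionField, (∀ z ∈ Z, ∃ a ∈ maximalIdeal (C.presheaf.stalk z),
      ∃ c : C.presheaf.stalk z, algebraMap _ C.functionField a = h ∧ g * h = algebraMap _ C.functionField c) ∧
      ∀ t ∈ T, ∃ u : (C.presheaf.stalk t)ˣ, algebraMap _ C.functionField u.1 = h := by
  obtain ⟨U, hU, hUZT⟩ := hC.exists_isAffineOpen (hZ.union hT) (by
    rintro x (hx | hx)
    exacts [hZc x hx, hTc x hx])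
  have hinj : Function.Injective (Subtype.val : U → C) := Subtype.val_injective
  obtain ⟨h, c, hhZ, hhT, hc⟩ := exists_germ_eq_denominator hU
    (hZ.preimage hinj.injOn) (hT.preimage hinj.injOn)
    ⟨⟨hT0.some, hUZT (.inr hT0.some_mem)⟩, hT0.some_mem⟩ (fun z hz ↦ hZc z.1 hz)
    (hZT.preimage _) (fun t ht ↦ hg t.1 ht)
  have : Nonempty U := ⟨⟨hT0.some, hUZT (.inr hT0.some_mem)⟩⟩
  have halg (x : U) : algebraMap (C.presheaf.stalk x.1) C.functionField
      (C.presheaf.germ U x.1 x.2 h) = C.germToFunctionField U h :=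
    C.algebraMap_germ_eq_germToFunctionField x.2 h
  refine ⟨C.germToFunctionField U h, fun z hz ↦ ?_, fun t ht ↦ ?_⟩
  · have hzU : z ∈ U := hUZT (.inl hz)
    refine ⟨_, hhZ ⟨z, hzU⟩ hz, C.presheaf.germ U z hzU c, halg ⟨z, hzU⟩, ?_⟩
    rw [← halg ⟨z, hzU⟩]
    exact hc ⟨z, hzU⟩
  · obtain ⟨u, hu⟩ := hhT ⟨t, hUZT (.inr ht)⟩ ht
    exact ⟨u, hu ▸ halg ⟨t, _⟩⟩

/-- A curve in characteristic `p` carries a rational function which is unramified at all its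
regular points, all of whose poles are multiple, with poles in `S` and none in `T`. -/
lemma IsCurve.exists_functionField (p : ℕ) [Fact p.Prime] [CharP K p] [IsIntegral C]
    (hC : IsCurve f) {S T : Set C} (hS : S.Finite) (hT : T.Finite) (hT0 : T.Nonempty)
    (hSc : ∀ s ∈ S, IsClosed {s}) (hTc : ∀ t ∈ T, IsClosed {t}) (hST : Disjoint S T) :
    ∃ φ : C.functionField, (∀ x, IsRegularUnramifiedAt f x φ ∨ HasMultiplePoleAt x φ) ∧
      (∀ s ∈ S, HasMultiplePoleAt s φ) ∧ ∀ t ∈ T, IsRegularUnramifiedAt f t φ := by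
  have hp : 2 ≤ p := (Fact.out : p.Prime).two_le
  have := hC.smooth
  obtain ⟨g, hgT, hgη, hgf⟩ := exists_isRegularUnramifiedAt hC hT hT0 hTc
  -- Poles are forced at S and wherever g fails to be regular and unramified.
  let Z : Set C := S ∪ {x | ¬ IsRegularUnramifiedAt f x g}
  have hZc : ∀ z ∈ Z, IsClosed {z} := by
    rintro z (hz | hz)
    · exact hSc z hz
    · refine isClosed_singleton f ?_
      rintro rfl
      exact hz hgη
  have hZT : Disjoint Z T :=
    Set.disjoint_union_left.mpr ⟨hST, Set.disjoint_left.mpr fun x hx hxT ↦ hx (hgT x hxT)⟩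
  obtain ⟨h, hhZ, hhT⟩ := hC.exists_denominator (hS.union hgf) hT hT0 hZc hTc hZT (g := g)
    fun t ht ↦ (hgT t ht).imp fun _ ↦ And.right
  have hh0 : h ≠ 0 := by
    obtain ⟨u, rfl⟩ := hhT _ hT0.some_mem
    exact (u.isUnit.map _).ne_zero
  have hpole : ∀ x ∈ Z, HasMultiplePoleAt x (g + h⁻¹ ^ p) := by
    intro x hx
    obtain ⟨a, ha, c, rfl, hc⟩ := hhZ x hx
    exact IsSmoothCurveLocalRing.exists_inverse_mem_sq p hp ha hh0 hc
  -- Outside Z the function h is uncontrolled, but g is unramified there and the local dichotomy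
  -- covers every h ≠ 0.
  refine ⟨g + h⁻¹ ^ p, fun x ↦ ?_, fun x hx ↦ hpole x (.inl hx), fun x hx ↦ ?_⟩
  · by_cases hx : IsRegularUnramifiedAt f x g
    · obtain ⟨a, ha, rfl⟩ := hx
      exact (isSmoothCurveLocalRing_toStalk f x).isUnramifiedElt_or_exists_inverse p hp ha hh0
    · exact .inr (hpole x (.inr hx))
  · obtain ⟨a, ha, rfl⟩ := hgT x hx
    obtain ⟨u, rfl⟩ := hhT x hx
    refine ⟨a + ↑u⁻¹ ^ p,
      (isSmoothCurveLocalRing_toStalk f x).isUnramifiedElt_add_pow p ha _, ?_⟩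
    rw [map_add, map_pow]
    congr 2
    exact (inv_eq_of_mul_eq_one_right (by rw [← map_mul]; simp)).symm

end Sections

end BelyiCharP

end

noncomputable section

namespace BelyiCharP

attribute [local instance] MvPolynomial.gradedAlgebra

/-! ### From the rational function to a finite morphism -/

open IsLocalRing

/-- Whether q vanishes on the affine coordinate at x depends only on φ(x); this is used to compare a
closed point with the generic point. -/
lemma eval₂_mem_maximalIdeal_iff {K : Type u} [Field K] {X : Scheme.{u}} (φ : X ⟶ ProjSpace 1 K)
    (i j : Fin (1 + 1)) {x : X} {k : K →+* X.presheaf.stalk x}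
    {v : Fin (1 + 1) → X.presheaf.stalk x} (hi : v i = 1)
    (h : X.fromSpecStalk x ≫ φ = toProjLine k v i (hi ▸ isUnit_one)) (q : Polynomial K) :
    q.eval₂ k (v j) ∈ maximalIdeal (X.presheaf.stalk x) ↔
      φ x ∈ chart K i '' {y | q.eval₂ ((HomogeneousLocalization.fromZeroRingHom (binaryGrading K)
        _).comp (algebraMap K (binaryGrading K 0))) (awayCoord K i j) ∈ y.asIdeal} := by
  have hP : IsUnit (MvPolynomial.eval₂Hom k v (MvPolynomial.X i)) := by simp [hi]
  have h1 : φ x = chart K i (Spec.map (CommRingCat.ofHom (evalAway k v (MvPolynomial.X i) hP))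
      (closedPoint (X.presheaf.stalk x))) := by
    have : φ (X.fromSpecStalk x (closedPoint (X.presheaf.stalk x))) =
      toProjLine k v i (hi ▸ isUnit_one) (closedPoint (X.presheaf.stalk x)) := by
      rw [← h]
      rfl
    rwa [Scheme.fromSpecStalk_closedPoint] at this
  have h2 := RingHom.congr_fun (evalAway_comp_eval₂RingHom k v i j hi hP) q
  rw [h1, (chart K i).isOpenEmbedding.injective.mem_set_image]
  simp only [RingHom.comp_apply, Polynomial.coe_eval₂RingHom] at h2
  rw [← h2]
  rfl

section FunctionField

variable {K : Type u} [Field K] {C : Scheme.{u}} [IsIntegral C]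
  {f : C ⟶ Spec (CommRingCat.of K)}

lemma IsRegularUnramifiedAt.not_hasMultiplePoleAt {x : C} {φ : C.functionField}
    (h : IsRegularUnramifiedAt f x φ) : ¬ HasMultiplePoleAt x φ := by
  rintro ⟨w, hw, hwφ⟩
  obtain ⟨b, -, rfl⟩ := h
  rw [← map_mul, map_eq_one_iff _ (IsFractionRing.injective _ _)] at hwφ
  exact (mem_maximalIdeal w).mp (Ideal.pow_le_self two_ne_zero hw)
    (IsUnit.of_mul_eq_one _ hwφ)

/-- The rational function `φ` extends to a morphism to the projective line. -/
lemma exists_hom_of_functionField (φ : C.functionField)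
    (hφ : ∀ x, IsRegularUnramifiedAt f x φ ∨ HasMultiplePoleAt x φ) :
    ∃ ψ : C ⟶ ProjSpace 1 K, ψ ≫ ProjSpace.toSpec 1 K = f ∧
      (∀ x, IsRegularUnramifiedAt f x φ → ∃ b, IsUnramifiedElt (toStalk f x) b ∧
        C.fromSpecStalk x ≫ ψ = toProjLine (toStalk f x) ![b, 1] 1 isUnit_one) ∧
      ∀ x, HasMultiplePoleAt x φ → ∃ w ∈ maximalIdeal (C.presheaf.stalk x) ^ 2,
        C.fromSpecStalk x ≫ ψ = toProjLine (toStalk f x) ![1, w] 0 isUnit_one := by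
  have key (x : C) : ∃ ψ : Spec (C.presheaf.stalk x) ⟶ ProjSpace 1 K,
      ψ ≫ ProjSpace.toSpec 1 K = C.fromSpecStalk x ≫ f ∧
      Spec.map (C.presheaf.stalkSpecializes (genericPoint_specializes x)) ≫ ψ =
        toProjLine (toStalk f (genericPoint C)) ![φ, 1] 1 isUnit_one ∧
      (IsRegularUnramifiedAt f x φ → ∃ b, IsUnramifiedElt (toStalk f x) b ∧
        ψ = toProjLine (toStalk f x) ![b, 1] 1 isUnit_one) ∧
      (HasMultiplePoleAt x φ → ∃ w ∈ maximalIdeal (C.presheaf.stalk x) ^ 2,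
        ψ = toProjLine (toStalk f x) ![1, w] 0 isUnit_one) := by
    -- Both local forms [b : 1] and [1 : w] become [φ : 1] over the function field, after scaling by
    -- 1 and by φ respectively.
    have hgen (v : Fin (1 + 1) → C.presheaf.stalk x) (i : Fin (1 + 1)) (hi : IsUnit (v i))
        (c : C.functionField) (hv : ![φ, 1] = fun j ↦ c * algebraMap _ C.functionField (v j)) :
        Spec.map (C.presheaf.stalkSpecializes (genericPoint_specializes x)) ≫
          toProjLine (toStalk f x) v i hi =
          toProjLine (toStalk f (genericPoint C)) ![φ, 1] 1 isUnit_one := by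
      have h1 := specMap_toProjLine (toStalk f x) v
        (C.presheaf.stalkSpecializes (genericPoint_specializes x)).hom i hi
      rw [CommRingCat.ofHom_hom] at h1
      refine h1.trans ?_
      rw [stalkSpecializes_comp_toStalk]
      exact toProjLine_smul _ _ _ _ _ c _ hv _
    rcases hφ x with h | h
    · obtain ⟨b, hb, hbφ⟩ := h
      refine ⟨toProjLine (toStalk f x) ![b, 1] 1 isUnit_one, ?_, ?_, fun _ ↦ ⟨b, hb, rfl⟩,
        fun h' ↦ absurd h' (IsRegularUnramifiedAt.not_hasMultiplePoleAt ⟨b, hb, hbφ⟩)⟩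
      · exact (toProjLine_toSpec _ _ _ _).trans (specMap_toStalk f x)
      · refine hgen _ _ _ 1 ?_
        ext j
        match j with
        | 0 => exact hbφ.symm.trans (one_mul _).symm
        | 1 => exact (map_one _).symm.trans (one_mul _).symm
    · obtain ⟨w, hw, hwφ⟩ := h
      refine ⟨toProjLine (toStalk f x) ![1, w] 0 isUnit_one, ?_, ?_,
        fun h' ↦ absurd ⟨w, hw, hwφ⟩ h'.not_hasMultiplePoleAt, fun _ ↦ ⟨w, hw, rfl⟩⟩
      · exact (toProjLine_toSpec _ _ _ _).trans (specMap_toStalk f x)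
      · refine hgen _ _ _ φ ?_
        ext j
        match j with
        | 0 => exact (mul_one φ).symm.trans (congrArg _ (map_one _).symm)
        | 1 => exact hwφ.symm.trans (mul_comm _ _)
  choose ψ hψ hψ' hA hB using key
  obtain ⟨φ', h, h'⟩ := exists_hom_of_fromSpecStalk f (ProjSpace.toSpec 1 K) ψ hψ _ hψ'
  refine ⟨φ', h, fun x hx ↦ ?_, fun x hx ↦ ?_⟩
  · rw [h']
    exact hA x hx
  · rw [h']
    exact hB x hx

variable {φ : C.functionField} {ψ : C ⟶ ProjSpace 1 K}
  (hA : ∀ x, IsRegularUnramifiedAt f x φ → ∃ b, IsUnramifiedElt (toStalk f x) b ∧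
        C.fromSpecStalk x ≫ ψ = toProjLine (toStalk f x) ![b, 1] 1 isUnit_one)
  (hB : ∀ x, HasMultiplePoleAt x φ → ∃ w ∈ maximalIdeal (C.presheaf.stalk x) ^ 2,
        C.fromSpecStalk x ≫ ψ = toProjLine (toStalk f x) ![1, w] 0 isUnit_one)

include hA in
lemma IsRegularUnramifiedAt.formallyUnramified_stalkMap_and_mem {x : C}
    (h : IsRegularUnramifiedAt f x φ) : (ψ.stalkMap x).hom.FormallyUnramified ∧
      ψ x ∈ Proj.basicOpen (binaryGrading K) (MvPolynomial.X 1) := by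
  obtain ⟨b, hb, hψ⟩ := hA x h
  exact ⟨(formallyUnramified_stalkMap_iff ψ x _ ![b, 1] one_ne_zero rfl hψ).mpr hb,
    (mem_basicOpen_iff_isUnit ψ x _ _ 1 1 _ hψ).mpr isUnit_one⟩

variable [SmoothOfRelativeDimension 1 f]

include hB in
lemma HasMultiplePoleAt.not_formallyUnramified_stalkMap_and_notMem {x : C}
    (h : HasMultiplePoleAt x φ) : ¬ (ψ.stalkMap x).hom.FormallyUnramified ∧
      ψ x ∉ Proj.basicOpen (binaryGrading K) (MvPolynomial.X 1) := by
  obtain ⟨w, hw, hψ⟩ := hB x h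
  rw [formallyUnramified_stalkMap_iff ψ x _ ![1, w] zero_ne_one rfl hψ,
    mem_basicOpen_iff_isUnit ψ x _ _ 0 1 _ hψ]
  exact ⟨(isSmoothCurveLocalRing_toStalk f x).not_isUnramifiedElt_of_mem hw,
    (mem_maximalIdeal w).mp (Ideal.pow_le_self two_ne_zero hw)⟩

include hA hB in
-- At a closed point where φ is regular its value is a root of some q ≠ 0. An equal image would give
-- q(φ) = 0 in the function field, against transcendence of an unramified element. Poles leave the
-- affine chart that contains the image of the generic point.
lemma apply_ne_apply_genericPoint [PerfectField K]
    (hφ : ∀ x, IsRegularUnramifiedAt f x φ ∨ HasMultiplePoleAt x φ) {x : C}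
    (hx : x ≠ genericPoint C) : ψ x ≠ ψ (genericPoint C) := by
  -- The stalk at the generic point is a field, so an inverse lying in 𝔪² would be zero.
  have hη : IsRegularUnramifiedAt f (genericPoint C) φ := by
    refine (hφ _).resolve_right ?_
    rintro ⟨w, hw, hwφ⟩
    have h0 : maximalIdeal C.functionField = ⊥ := maximalIdeal_eq_bot
    rw [h0, ← Ideal.zero_eq_bot, zero_pow two_ne_zero, Ideal.zero_eq_bot, Ideal.mem_bot] at hw
    simp [hw] at hwφ
  intro h
  rcases hφ x with h1 | h1
  · have := SmoothOfRelativeDimension.smooth 1 f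
    obtain ⟨P, rfl⟩ := exists_geomPoint_of_isClosed (f := f) (isClosed_singleton f hx)
    obtain ⟨b, hb, hψ⟩ := hA _ h1
    obtain ⟨c, hc, hψ'⟩ := hA _ hη
    obtain ⟨q, hq, hqb⟩ := P.exists_eval₂_mem_maximalIdeal b
    have h2 := (eval₂_mem_maximalIdeal_iff ψ 1 0 (v := ![b, 1]) rfl hψ q).mp hqb
    rw [h] at h2
    have h3 := (eval₂_mem_maximalIdeal_iff ψ 1 0 (v := ![c, 1]) rfl hψ' q).mpr h2
    have h0 : maximalIdeal C.functionField = ⊥ := maximalIdeal_eq_bot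
    rw [h0, Ideal.mem_bot] at h3
    exact (isSmoothCurveLocalRing_toStalk f _).eval₂_ne_zero_of_isUnramifiedElt hc hq h3
  · exact (h1.not_formallyUnramified_stalkMap_and_notMem hB).2
      (h ▸ (hη.formallyUnramified_stalkMap_and_mem hA).2)

/-- A proper morphism with finite fibres is finite. The fibre through the generic point is a
singleton; any other nonempty fibre lies over a closed point, so it is a closed set missing the
generic point. -/
lemma isFinite_of_apply_ne_apply_genericPoint [IsProper f]
    (hψ : ψ ≫ ProjSpace.toSpec 1 K = f)
    (h : ∀ x, x ≠ genericPoint C → ψ x ≠ ψ (genericPoint C)) : IsFinite ψ := by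
  have : IsProper (ψ ≫ ProjSpace.toSpec 1 K) := hψ ▸ ‹_›
  have : IsProper ψ := .of_comp _ (ProjSpace.toSpec 1 K)
  have : LocallyQuasiFinite ψ := by
    refine locallyQuasiFinite_iff_finite_preimage_singleton.mpr fun y ↦ ?_
    by_cases hy : ψ (genericPoint C) = y
    · refine (Set.finite_singleton (genericPoint C)).subset fun x hx ↦ ?_
      by_contra hxη
      exact h x hxη (hx.trans hy.symm)
    · rcases (ψ ⁻¹' {y}).eq_empty_or_nonempty with h0 | ⟨x, hx⟩
      · exact h0 ▸ Set.finite_empty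
      · obtain rfl : ψ x = y := hx
        have hxη : x ≠ genericPoint C := fun h0 ↦ hy (h0 ▸ rfl)
        have h1 := ψ.isClosedMap _ (isClosed_singleton f hxη)
        rw [Set.image_singleton] at h1
        exact finite_of_isClosed f (h1.preimage ψ.continuous) hy
  exact .of_isProper_of_locallyQuasiFinite ψ

end FunctionField

end BelyiCharP

end

theorem theorem1p2 {K : Type u} [Field K] [PerfectField K] (p : ℕ) [Fact p.Prime] [CharP K p]
    {C : Scheme.{u}} (f : C ⟶ Spec (CommRingCat.of K)) (hC : BelyiCharP.IsCurve f)
    (S T : Set (BelyiCharP.GeomPoint f)) (hS : S.Finite) (hT : T.Finite)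
    (hST : ∀ s ∈ S, ∀ t ∈ T, ∀ σ : AlgebraicClosure K ≃ₐ[K] AlgebraicClosure K, s ≠ t.conj σ) :
    ∃ (φ : C ⟶ BelyiCharP.ProjSpace 1 K) (hφ : φ ≫ BelyiCharP.ProjSpace.toSpec 1 K = f),
      IsFinite φ ∧
      BelyiCharP.branchLocus φ hφ = {BelyiCharP.infty K} ∧
      (∀ s ∈ S, BelyiCharP.IsRamifiedAt φ s) ∧
      BelyiCharP.infty K ∉ BelyiCharP.GeomPoint.map φ hφ '' T := by
  have hsmooth := hC.smooth
  have := hC.isIntegral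
  have := hC.isProper
  have := SmoothOfRelativeDimension.smooth 1 f
  have hclosed (P : BelyiCharP.GeomPoint f) : IsClosed {P.pt} :=
    BelyiCharP.isClosed_singleton f P.pt_ne_genericPoint
  have havoid (A : Set C) (hA : A.Finite) (hAc : ∀ x ∈ A, IsClosed {x})
      (hη : genericPoint C ∉ A) : ∃ P : BelyiCharP.GeomPoint f, P.pt ∉ A := by
    have hAcl : IsClosed A := by
      rw [← Set.biUnion_of_singleton A]
      exact hA.isClosed_biUnion hAc
    obtain ⟨P, hP⟩ := BelyiCharP.exists_geomPoint_mem (f := f) ⟨Aᶜ, hAcl.isOpen_compl⟩ ⟨_, hη⟩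
    exact ⟨P, hP⟩
  have havoid' (A : Set (BelyiCharP.GeomPoint f)) (hA : A.Finite) :
      ∃ P : BelyiCharP.GeomPoint f, P.pt ∉ BelyiCharP.GeomPoint.pt '' A := by
    refine havoid _ (hA.image _) ?_ ?_
    · rintro _ ⟨P, -, rfl⟩
      exact hclosed P
    · rintro ⟨P, -, hP⟩
      exact P.pt_ne_genericPoint hP
  -- Auxiliary points: `t₀` makes T nonempty, as the construction requires, and `s₀` guarantees a
  -- pole even when S is empty, so that ∞ really is a branch point.
  obtain ⟨t₀, ht₀⟩ := havoid' S hS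
  obtain ⟨s₀, hs₀⟩ := havoid' (insert t₀ T) (hT.insert t₀)
  have hdisj : Disjoint (BelyiCharP.GeomPoint.pt '' insert s₀ S)
      (BelyiCharP.GeomPoint.pt '' insert t₀ T) := by
    rw [Set.disjoint_left]
    rintro _ ⟨s, rfl | hs, rfl⟩ hst
    · exact hs₀ hst
    · obtain ⟨t, rfl | ht, hst⟩ := hst
      · exact ht₀ ⟨s, hs, hst.symm⟩
      -- Geometric points over the same closed point are conjugate, which the hypothesis on S and T
      -- excludes.
      · obtain ⟨σ, hσ⟩ := BelyiCharP.GeomPoint.exists_eq_conj hst.symm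
        exact hST s hs t ht σ hσ
  obtain ⟨φ, hφ, hφS, hφT⟩ := hC.exists_functionField p ((hS.insert s₀).image _)
    ((hT.insert t₀).image _) ((Set.insert_nonempty t₀ T).image _)
    (by rintro _ ⟨P, -, rfl⟩; exact hclosed P) (by rintro _ ⟨P, -, rfl⟩; exact hclosed P) hdisj
  obtain ⟨ψ, hψ, hA, hB⟩ := BelyiCharP.exists_hom_of_functionField φ hφ
  have hreg {x : C} (h : BelyiCharP.IsRegularUnramifiedAt f x φ) :=
    h.formallyUnramified_stalkMap_and_mem hA
  have hpole {x : C} (h : BelyiCharP.HasMultiplePoleAt x φ) :=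
    h.not_formallyUnramified_stalkMap_and_notMem (f := f) hB
  refine ⟨ψ, hψ, BelyiCharP.isFinite_of_apply_ne_apply_genericPoint hψ fun x hx ↦
    BelyiCharP.apply_ne_apply_genericPoint hA hB hφ hx, ?_, fun s hs ↦
    (hpole (hφS _ ⟨s, .inr hs, rfl⟩)).1, ?_⟩
  · ext y
    rw [Set.mem_singleton_iff]
    constructor
    · rintro ⟨P, hP, rfl⟩
      rw [BelyiCharP.GeomPoint.eq_infty_iff]
      exact (hpole ((hφ P.pt).resolve_left fun h ↦ hP (hreg h).1)).2
    · rintro rfl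
      have h := hpole (hφS _ ⟨s₀, .inl rfl, rfl⟩)
      exact ⟨s₀, h.1, BelyiCharP.GeomPoint.eq_infty_iff.mpr h.2⟩
  · rintro ⟨t, ht, h⟩
    exact BelyiCharP.GeomPoint.eq_infty_iff.mp h (hreg (hφT _ ⟨t, .inr ht, rfl⟩)).2
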